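/- Let $M$ be a closed manifold of dimension $n\ge 1$ (smooth, compact, connected, Hausdorff, without boundary), let $F$ be a Finsler metric on $M$ (i.e. $F:TM\to[0,\infty)$ is $C^\infty$ off the zero section, $F(cv)=cF(v)$ for $c\ge 0$, and $g_v:=\frac12 D^2(F^2|_{T_xM})(v)$ is positive definite for all $v\in T_xM\setminus\{0\}$; $F$ need not be reversible), and let $\mathfrak m$ be a positive $C^\infty$ measure on $M$, i.e. $d\mathfrak m=e^{\Phi}dx^1\cdots dx^n$ with $\Phi$ smooth in every smooth chart. Suppose that the real number $\sigma$ satisfies $$\sigma_F:=\sup_{x\in M}\ \sup_{v,w\in T_xM\setminus\{0\}}\frac{g_v(w,w)}{F(w)^2}\le\sigma .$$ Then for every real $p>1$, $$\lambda_{1,p}(M)\ \ge\ \left(\frac{\mathbf h(M)}{\sigma p}\right)^{p}.$$ Here $F^*(\alpha)=\sup\{\alpha(v):v\in T_xM,\ F(v)\le 1\}$ for $\alpha\in T_x^*M$; $J^*(\alpha)$ is the unique maximizer of $v\mapsto \alpha(v)-\frac12F(v)^2$ on $T_xM$; $W^{1,p}(M)$ is the completion of $C^\infty(M)$ for $\|f\|_{L^p(\mathfrak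 m)}+\|F^*(df)\|_{L^p(\mathfrak m)}$; $\nabla f=J^*(df)$; and $$\lambda_{1,p}(M)=\inf\left\{\frac{\int_M F(\nabla f)^p\,d\mathfrak m}{\int_M|f|^p\,d\mathfrak m}\ :\ f\in W^{1,p}(M)\setminus\{0\},\ \int_M|f|^{p-2}f\,d\mathfrak m=0\right\}.$$ The Finsler Cheeger constant is $$\mathbf h(M)=\inf_\Gamma\frac{\min\{A_+(\Gamma),A_-(\Gamma)\}}{\min\{\mathfrak m(D_1),\mathfrak m(D_2)\}},$$ where $\Gamma$ runs over the smooth embedded $(n-1)$-dimensional submanifolds of $M$ whose complement is the union of two disjoint nonempty open sets $D_1,D_2$ with $\partial D_1=\partial D_2=\Gamma$, and $A_\pm(\Gamma)=\int_\Gamma|\iota_{\mathbf n_\pm}d\mathfrak m|$ are the areas of $\Gamma$ induced by its outward and inward unit normals: $\mathbf n_+$ points into $D_2$, $\mathbf n_-$ points into $D_1$, and both satisfy $F(\mathbf n)=1$ and $g_{\mathbf n}(\mathbf n,w)=0$ for all $w\in T\Gamma$. -/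

import Mathlib

open Set Filter Topology MeasureTheory
open scoped Manifold ContDiff ENNReal

noncomputable section

namespace Finsler

/-- The model space `ℝ^{d+1}`; all manifolds below have dimension `n = d + 1 ≥ 1`. -/
abbrev Model (d : ℕ) : Type := EuclideanSpace ℝ (Fin (d + 1))

variable {d : ℕ} {M : Type*} [TopologicalSpace M] [ChartedSpace (Model d) M]

section Metric

variable [IsManifold (𝓡 (d + 1)) ∞ M]

variable (d M) in
/-- A Finsler metric on a smooth manifold `M` of dimension `d + 1`: a nonnegative function on `TM`,
smooth off the zero section, positively 1-homogeneous and strongly convex. The Hessian in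
`strongly_convex` is that of the restriction of `F²` to the vector space `T_xM`. -/
structure Metric where
  toFun : (x : M) → TangentSpace (𝓡 (d + 1)) x → ℝ
  nonneg : ∀ x v, 0 ≤ toFun x v
  smooth : ContMDiffOn (𝓡 (d + 1)).tangent 𝓘(ℝ, ℝ) ∞
    (fun v : TangentBundle (𝓡 (d + 1)) M => toFun v.1 v.2) {v | v.2 ≠ 0}
  homogeneous : ∀ (x : M) (c : ℝ) (v : TangentSpace (𝓡 (d + 1)) x),
    0 ≤ c → toFun x (c • v) = c * toFun x v
  strongly_convex : ∀ (x : M) (v w : Model d), v ≠ 0 → w ≠ 0 →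
    0 < (1 / 2 : ℝ) * fderiv ℝ (fderiv ℝ (fun u : Model d => (toFun x u) ^ 2)) v w w

/-- The fundamental tensor `g_v(a, b) = ½ ∂²(F²)/∂vⁱ∂vʲ (v) aⁱ bʲ` on `T_xM`. -/
def Metric.fundamental (F : Metric d M) (x : M) (v a b : TangentSpace (𝓡 (d + 1)) x) : ℝ :=
  (1 / 2 : ℝ) * fderiv ℝ (fderiv ℝ (fun u : Model d => (F.toFun x u) ^ 2))
    (v : Model d) (a : Model d) (b : Model d)

/-- The 2-uniform concavity constant `σ_F = sup_x sup_{v,w ≠ 0} g_v(w, w) / F(w)²`. -/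
def Metric.concavity (F : Metric d M) : ℝ≥0∞ :=
  ⨆ (x : M) (v : TangentSpace (𝓡 (d + 1)) x) (w : TangentSpace (𝓡 (d + 1)) x)
    (_ : v ≠ 0) (_ : w ≠ 0), ENNReal.ofReal (F.fundamental x v w w / (F.toFun x w) ^ 2)

/-- The dual metric `F*(α) = sup { α(v) | v ∈ T_xM, F(v) ≤ 1 }`. -/
def Metric.dual (F : Metric d M) (x : M) (α : TangentSpace (𝓡 (d + 1)) x →L[ℝ] ℝ) : ℝ :=
  sSup {r : ℝ | ∃ v : TangentSpace (𝓡 (d + 1)) x, F.toFun x v ≤ 1 ∧ α v = r}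

/-- The Legendre transform `J*`: the (unique) maximizer of `v ↦ α(v) - ½ F²(v)` on `T_xM`. -/
def Metric.legendre (F : Metric d M) (x : M) (α : TangentSpace (𝓡 (d + 1)) x →L[ℝ] ℝ) :
    TangentSpace (𝓡 (d + 1)) x :=
  Classical.epsilon fun v : TangentSpace (𝓡 (d + 1)) x =>
    ∀ w : TangentSpace (𝓡 (d + 1)) x,
      α w - (1 / 2 : ℝ) * (F.toFun x w) ^ 2 ≤ α v - (1 / 2 : ℝ) * (F.toFun x v) ^ 2

end Metric

/-- The differential of a real function at a point, as a covector. -/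
def differential (f : M → ℝ) (x : M) : TangentSpace (𝓡 (d + 1)) x →L[ℝ] ℝ :=
  mfderiv (𝓡 (d + 1)) 𝓘(ℝ, ℝ) f x

/-- `e` is a chart of the (maximal) smooth atlas of `M`. -/
def IsChart (e : OpenPartialHomeomorph M (Model d)) : Prop :=
  e ∈ IsManifold.maximalAtlas (𝓡 (d + 1)) ∞ M

variable (d M) in
/-- A positive `C^∞` measure on `M`: a Borel measure which in every smooth chart `e` is
`e^{Φ_e} dx¹ ⋯ dxⁿ` with `Φ_e` smooth. (`Φ_e` is determined on the target of `e`.) -/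
structure SmoothMeasure [MeasurableSpace M] where
  measure : Measure M
  logDensity : OpenPartialHomeomorph M (Model d) → Model d → ℝ
  smooth : ∀ e : OpenPartialHomeomorph M (Model d), IsChart e →
    ContDiffOn ℝ ∞ (logDensity e) e.target
  chart_eq : ∀ e : OpenPartialHomeomorph M (Model d), IsChart e →
    ∀ B : Set (Model d), MeasurableSet B → B ⊆ e.target →
      measure (e.symm '' B) = ∫⁻ z in B, ENNReal.ofReal (Real.exp (logDensity e z))

section Eigenvalue

variable [IsManifold (𝓡 (d + 1)) ∞ M] [MeasurableSpace M]

/-- A covector field is measurable if its components in the charts of the atlas are. -/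
def MeasurableCovectorField (m : Measure M)
    (α : (x : M) → TangentSpace (𝓡 (d + 1)) x →L[ℝ] ℝ) : Prop :=
  ∀ x₀ : M, AEMeasurable
    (fun x : M => ((α x : Model d →L[ℝ] ℝ).comp (tangentCoordChange (𝓡 (d + 1)) x₀ x x)))
    (m.restrict (chartAt (Model d) x₀).source)

/-- `f` belongs to `W^{1,p}(M)`, the completion of `C^∞(M)` for the norm
`‖f‖_{L^p} + ‖F*(df)‖_{L^p}`, and `α` is its differential: `(f, α)` is the limit in `L^p` of
`(f_k, df_k)` for some smooth functions `f_k`. -/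
def IsSobolev (F : Metric d M) (m : SmoothMeasure d M) (p : ℝ) (f : M → ℝ)
    (α : (x : M) → TangentSpace (𝓡 (d + 1)) x →L[ℝ] ℝ) : Prop :=
  MemLp f (ENNReal.ofReal p) m.measure ∧ MeasurableCovectorField m.measure α ∧
  ∃ u : ℕ → M → ℝ, (∀ k, ContMDiff (𝓡 (d + 1)) 𝓘(ℝ, ℝ) ∞ (u k)) ∧
    Tendsto (fun k => ∫⁻ x, ENNReal.ofReal (|u k x - f x| ^ p) ∂m.measure) atTop (𝓝 0) ∧
    Tendsto (fun k => ∫⁻ x, ENNReal.ofReal (F.dual x (differential (u k) x - α x) ^ p) ∂m.measure)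
      atTop (𝓝 0)

/-- The energy `E(f) = ∫ F(∇f)^p dm / ∫ |f|^p dm`, where `∇f = J*(df)` and `α = df`. -/
def energy (F : Metric d M) (m : SmoothMeasure d M) (p : ℝ) (f : M → ℝ)
    (α : (x : M) → TangentSpace (𝓡 (d + 1)) x →L[ℝ] ℝ) : ℝ≥0∞ :=
  (∫⁻ x, ENNReal.ofReal (F.toFun x (F.legendre x (α x)) ^ p) ∂m.measure) /
    (∫⁻ x, ENNReal.ofReal (|f x| ^ p) ∂m.measure)

/-- The first closed eigenvalue of the Finsler `p`-Laplacian: the infimum of the energy over the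
nonzero `f ∈ W^{1,p}(M)` with `∫ |f|^{p-2} f dm = 0`. -/
def firstEigenvalue (F : Metric d M) (m : SmoothMeasure d M) (p : ℝ) : ℝ≥0∞ :=
  ⨅ (f : M → ℝ) (α : (x : M) → TangentSpace (𝓡 (d + 1)) x →L[ℝ] ℝ)
    (_ : IsSobolev F m p f α) (_ : ¬ f =ᵐ[m.measure] 0)
    (_ : ∫ x, |f x| ^ (p - 2) * f x ∂m.measure = 0), energy F m p f α

end Eigenvalue

section Cheeger

/-- `e` is a slice chart for `Γ`: a smooth chart in which `Γ` is the hyperplane `{x⁰ = 0}`. -/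
def IsSliceChart (Γ : Set M) (e : OpenPartialHomeomorph M (Model d)) : Prop :=
  IsChart e ∧ ∀ x ∈ e.source, x ∈ Γ ↔ e x 0 = 0

variable (d) in
/-- `Γ` is a smooth embedded submanifold of codimension one. -/
def IsHypersurface (Γ : Set M) : Prop :=
  ∀ x ∈ Γ, ∃ e : OpenPartialHomeomorph M (Model d), IsSliceChart Γ e ∧ x ∈ e.source

/-- `w` is tangent to the hypersurface `Γ` at `x`. -/
def IsTangent (Γ : Set M) (x : M) (w : TangentSpace (𝓡 (d + 1)) x) : Prop :=
  ∀ e : OpenPartialHomeomorph M (Model d), IsSliceChart Γ e → x ∈ e.source →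
    differential (fun z => e z 0) x w = 0

/-- `v ∈ T_xM` points into `D`: moving from `x` in the direction `v` (in the preferred chart at
`x`, through which Mathlib identifies `T_xM` with the model space) enters `D`. -/
def PointsInto (D : Set M) (x : M) (v : TangentSpace (𝓡 (d + 1)) x) : Prop :=
  ∀ᶠ t in 𝓝[>] (0 : ℝ),
    (chartAt (Model d) x).symm (chartAt (Model d) x x + (show Model d from t • v)) ∈ D

/-- `Γ` is a hypersurface which divides `M` into the disjoint nonempty open sets `D₁` and `D₂`
with common boundary `Γ`. -/
structure Divides (d : ℕ) {M : Type*} [TopologicalSpace M] [ChartedSpace (Model d) M]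
    (Γ D₁ D₂ : Set M) : Prop where
  hypersurface : IsHypersurface d Γ
  open₁ : IsOpen D₁
  open₂ : IsOpen D₂
  nonempty₁ : D₁.Nonempty
  nonempty₂ : D₂.Nonempty
  disjoint : Disjoint D₁ D₂
  union : D₁ ∪ D₂ = Γᶜ
  frontier₁ : frontier D₁ = Γ
  frontier₂ : frontier D₂ = Γ

/-- The point `(0, y)` of the hyperplane `{x⁰ = 0}`. -/
def slicePoint (y : EuclideanSpace ℝ (Fin d)) : Model d :=
  WithLp.toLp 2 (Fin.cons (0 : ℝ) (fun i => y i) : Fin (d + 1) → ℝ)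

/-- The area element `|ι_n dm|` of `Γ` in a slice chart `e`. Since `dm = e^Φ dx⁰ ∧ ⋯ ∧ dx^d` and
`Γ = {x⁰ = 0}`, it is `e^{Φ(0,y)} |dx⁰(n)| dy¹ ⋯ dy^d`. -/
def sliceArea [MeasurableSpace M] (m : SmoothMeasure d M)
    (n : (x : M) → TangentSpace (𝓡 (d + 1)) x) (e : OpenPartialHomeomorph M (Model d)) :
    Measure M :=
  ((volume.restrict {y : EuclideanSpace ℝ (Fin d) | slicePoint y ∈ e.target}).withDensity
    (fun y => ENNReal.ofReal (Real.exp (m.logDensity e (slicePoint y)) *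
      |differential (fun z => e z 0) (e.symm (slicePoint y)) (n (e.symm (slicePoint y)))|))).map
    (fun y => e.symm (slicePoint y))

/-- The area `A_n(Γ) = ∫_Γ |ι_n dm|`. The area elements of two slice charts agree where both
are defined, so the measure on `Γ` obtained by gluing them is their supremum. -/
def area [MeasurableSpace M] (m : SmoothMeasure d M)
    (n : (x : M) → TangentSpace (𝓡 (d + 1)) x) (Γ : Set M) : ℝ≥0∞ :=
  (⨆ (e : OpenPartialHomeomorph M (Model d)) (_ : IsSliceChart Γ e), sliceArea m n e) univ

variable [IsManifold (𝓡 (d + 1)) ∞ M]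

/-- The (unique) `F`-unit normal vector of the hypersurface `Γ` at `x ∈ Γ` pointing into `D`:
`F(n) = 1`, `g_n(n, w) = 0` for all `w ∈ T_xΓ`, and `n` points into `D`. -/
def Metric.unitNormal (F : Metric d M) (Γ D : Set M) (x : M) : TangentSpace (𝓡 (d + 1)) x :=
  Classical.epsilon fun n : TangentSpace (𝓡 (d + 1)) x =>
    F.toFun x n = 1 ∧ (∀ w, IsTangent Γ x w → F.fundamental x n n w = 0) ∧ PointsInto D x n

/-- Cheeger's constant. For `Γ = ∂D₁ = ∂D₂`, the normal pointing into `D₂` is the outward normal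
and the one pointing into `D₁` is the inward normal of `D₁`. -/
def cheeger [MeasurableSpace M] (F : Metric d M) (m : SmoothMeasure d M) : ℝ≥0∞ :=
  ⨅ (Γ : Set M) (D₁ : Set M) (D₂ : Set M) (_ : Divides d Γ D₁ D₂),
    min (area m (F.unitNormal Γ D₂) Γ) (area m (F.unitNormal Γ D₁) Γ) /
      min (m.measure D₁) (m.measure D₂)

end Cheeger

end Finsler

end

/-! The argument proves the stronger bound `(h / p) ^ p ≤ λ`, where `h` is the Cheeger constant and
`λ` the first eigenvalue. The constant `σ` enters only through `1 ≤ σ`, which holds because `g_v(v,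
v) = F(v)²`.

Let `v` be smooth with median `0`. The layer-cake formula writes `∫ |v|^p` as the integral over `t`
of `p |t|^(p-1)` times the measure of `{v > t}` for `t > 0`, and of `{v < t}` for `t < 0`. The
median condition makes this measure the smaller of the two sides of the level `{v = t}`. For a
regular value `t` the level is an admissible hypersurface, so `h` times that smaller measure is at
most the area of the level (`cheeger_mul_le_area`). Sard's theorem makes almost every `t` regular.

Since `h` is defined with the minimum of the two areas, the normal towards increasing `v` may be
used for both signs of `t`. Only `F*(dv)`, never `F*(-dv)`, then appears, so reversibility plays no
role. In a chart whose zeroth coordinate is `v` the area density is `e^Φ |dv(n)|`, and `dv(n) ≤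
F*(dv) F(n) = F*(dv)`. Fubini in such charts yields the coarea inequality `coarea_le`. Together
these give `h ∫ |v|^p ≤ p ∫ |v|^(p-1) F*(dv)`, and Hölder's inequality gives `h ‖v‖_p ≤ p
‖F*(dv)‖_p` (`cheeger_mul_norm_le`).

Every smooth `u` satisfies this after subtraction of a median. If `∫ |f|^(p-2) f = 0`, convexity of
`|·|^p` shows that subtracting a constant cannot decrease `‖f‖_p`. Hence smooth approximations of
`f`, each with its own median, pass to the limit (`cheeger_mul_norm_le_of_isSobolev`). Finally
`F(J*(α)) = F*(α)` identifies the bound with one for the energy. -/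

namespace Finsler
noncomputable section

set_option linter.unusedSectionVars false

/-! ### Straightening a regular function -/

/-- A nonzero covector on the model space is the zeroth coordinate of a linear automorphism. -/
theorem exists_equiv_apply_zero {d : ℕ} {α : Model d →L[ℝ] ℝ} (hα : α ≠ 0) :
    ∃ L : Model d ≃L[ℝ] Model d, ∀ z, L z 0 = α z := by
  obtain ⟨i, hi⟩ : ∃ i, α (EuclideanSpace.single i 1) ≠ 0 := by
    by_contra! h
    apply hα
    ext z
    have hz := (EuclideanSpace.basisFun (Fin (d + 1)) ℝ).sum_repr z
    rw [← hz]
    simp [h]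
  -- In the standard basis, replace the `i`-th coordinate by `α`, listed first. This is invertible
  -- since `α` does not vanish on the `i`-th basis vector.
  let T : Model d →ₗ[ℝ] Model d :=
    { toFun := fun z => WithLp.toLp 2 (Fin.cons (α z) (fun j => z (i.succAbove j)) : Fin (d + 1) → ℝ)
      map_add' := by
        intro a b
        ext j
        refine Fin.cases ?_ (fun j => ?_) j <;> simp
      map_smul' := by
        intro c b
        ext j
        refine Fin.cases ?_ (fun j => ?_) j <;> simp }
  have hT : Function.Injective T := by
    rw [← LinearMap.ker_eq_bot, LinearMap.ker_eq_bot']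
    intro z hz
    have h0 : α z = 0 := by simpa [T] using congrArg (fun w : Model d => w 0) hz
    have hs : ∀ j, z (i.succAbove j) = 0 := fun j => by
      simpa [T] using congrArg (fun w : Model d => w j.succ) hz
    have hz' : z = z i • EuclideanSpace.single i 1 := by
      ext j
      rcases Fin.eq_self_or_eq_succAbove i j with rfl | ⟨k, rfl⟩
      · simp
      · simp [hs]
    have : z i = 0 := by
      rw [hz', map_smul, smul_eq_mul] at h0
      exact (mul_eq_zero.1 h0).resolve_right hi
    rw [hz', this, zero_smul]
  refine ⟨(LinearEquiv.ofInjectiveEndo T hT).toContinuousLinearEquiv, fun z => ?_⟩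
  simp [T]

/-- The inclusion `y ↦ (0, y)`. -/
def sliceL (d : ℕ) : EuclideanSpace ℝ (Fin d) →L[ℝ] Model d :=
  LinearMap.toContinuousLinearMap
    { toFun := slicePoint
      map_add' := fun a b => by
        ext j
        refine Fin.cases ?_ (fun j => ?_) j <;> simp [slicePoint]
      map_smul' := fun c b => by
        ext j
        refine Fin.cases ?_ (fun j => ?_) j <;> simp [slicePoint] }

/-- A smooth function with nonzero derivative is locally the zeroth coordinate of a
diffeomorphism. -/
theorem exists_straightening {d : ℕ} {U : Set (Model d)} (hU : IsOpen U) {g : Model d → ℝ}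
    (hg : ContDiffOn ℝ ∞ g U) {x : Model d} (hx : x ∈ U) (hd : fderiv ℝ g x ≠ 0) :
    ∃ φ : OpenPartialHomeomorph (Model d) (Model d), x ∈ φ.source ∧ φ.source ⊆ U ∧
      ContDiffOn ℝ ∞ φ φ.source ∧ ContDiffOn ℝ ∞ φ.symm φ.target ∧
      ∀ z, φ z 0 = g z := by
  obtain ⟨L, hL⟩ := exists_equiv_apply_zero hd
  -- The zeroth coordinate of `L` is the differential of `g` at `x`. Correcting it by the remainder
  -- makes the zeroth coordinate of `f` exactly `g` everywhere, while the derivative of `f` at `x`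
  -- stays `L`.
  let f : Model d → Model d := fun z => L z + (g z - fderiv ℝ g x z) • EuclideanSpace.single 0 1
  have hf : ContDiffOn ℝ ∞ f U := by
    refine L.contDiff.contDiffOn.add (ContDiffOn.smul (hg.sub ?_) contDiffOn_const)
    exact (fderiv ℝ g x).contDiff.contDiffOn
  have hfx : ContDiffAt ℝ ∞ f x := hf.contDiffAt (hU.mem_nhds hx)
  have hgx : HasFDerivAt g (fderiv ℝ g x) x :=
    ((hg.contDiffAt (hU.mem_nhds hx)).differentiableAt (by simp)).hasFDerivAt
  have hf' : HasFDerivAt f (L : Model d →L[ℝ] Model d) x := by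
    have := L.hasFDerivAt (x := x) |>.add
      ((hgx.sub (fderiv ℝ g x).hasFDerivAt).smul_const (EuclideanSpace.single (0 : Fin (d+1)) (1:ℝ)))
    convert! this using 1
    ext z
    simp
  have hn : (∞ : WithTop ℕ∞) ≠ 0 := by simp
  let φ₀ := hfx.toOpenPartialHomeomorph f hf' hn
  -- The inverse function theorem gives smoothness of the inverse only at the image of `x`.
  -- Restricting to the open set where the derivative is invertible gives it on the whole target.
  let W : Set (Model d) := U ∩ {z | IsUnit (fderiv ℝ f z)}
  have hfc : ContinuousOn (fderiv ℝ f) U := hf.continuousOn_fderiv_of_isOpen hU (by simp)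
  have hW : IsOpen W := hfc.isOpen_inter_preimage hU Units.isOpen
  have hxW : x ∈ W := by
    refine ⟨hx, ?_⟩
    change IsUnit (fderiv ℝ f x)
    rw [hf'.fderiv]
    exact ⟨ContinuousLinearEquiv.toUnit L, rfl⟩
  refine ⟨φ₀.restrOpen W hW, ?_, ?_, ?_, ?_, ?_⟩
  · exact ⟨hfx.mem_toOpenPartialHomeomorph_source hf' hn, hxW⟩
  · intro z hz
    exact hz.2.1
  · exact hf.mono fun z hz => hz.2.1
  · intro y hy
    apply ContDiffAt.contDiffWithinAt
    set φ := φ₀.restrOpen W hW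
    have hz : φ.symm y ∈ W := (φ.map_target hy).2
    obtain ⟨u, hu⟩ := hz.2
    refine φ.contDiffAt_symm (f₀' := ContinuousLinearEquiv.ofUnit u) hy ?_
      (hf.contDiffAt (hU.mem_nhds hz.1))
    have := ((hf.contDiffAt (hU.mem_nhds hz.1)).differentiableAt (by simp)).hasFDerivAt
    rw [← hu] at this
    exact this
  · intro z
    change f z 0 = g z
    simp [f, hL]

/-! ### Sard's theorem for real functions -/

section Sard

variable {E : Type} [NormedAddCommGroup E] [NormedSpace ℝ E]

/-- The derivatives of `g` of the orders `1, …, k` vanish at `x`. -/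
def Flat : ℕ → ∀ {F : Type} [NormedAddCommGroup F] [NormedSpace ℝ F], (E → F) → E → Prop
  | 0, _, _, _, _, _ => True
  | k + 1, _, _, _, g, x => fderiv ℝ g x = 0 ∧ Flat k (fderiv ℝ g) x

theorem contDiffOn_fderiv {F : Type} [NormedAddCommGroup F] [NormedSpace ℝ F] {U : Set E}
    (hU : IsOpen U) {g : E → F} (hg : ContDiffOn ℝ ∞ g U) : ContDiffOn ℝ ∞ (fderiv ℝ g) U :=
  hg.fderiv_of_isOpen hU (by simp)

/-- Taylor's estimate with a constant uniform near `x₀`. Each step applies the estimate to the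
derivative and integrates it along a segment by the mean value inequality, gaining one power. The
codomain varies because the induction passes from `g` to its derivative. -/
theorem Flat.norm_sub_le {U : Set E} (hU : IsOpen U) (k : ℕ) :
    ∀ {F : Type} [NormedAddCommGroup F] [NormedSpace ℝ F] {g : E → F},
    ContDiffOn ℝ ∞ g U → ∀ x₀ ∈ U, ∃ C : NNReal, ∃ r > 0, ∀ x ∈ Metric.ball x₀ r, Flat k g x →
      ∀ y ∈ Metric.ball x₀ r, ‖g y - g x‖ ≤ C * ‖y - x‖ ^ (k + 1) := by
  induction k with
  | zero =>
    intro F _ _ g hg x₀ hx₀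
    obtain ⟨K, t, ht, hK⟩ := ((hg.contDiffAt (hU.mem_nhds hx₀)).of_le
      (m := 1) (by simp)).exists_lipschitzOnWith
    obtain ⟨r, hr, hrt⟩ := Metric.mem_nhds_iff.1 ht
    refine ⟨K, r, hr, fun x hx _ y hy => ?_⟩
    simpa using hK.norm_sub_le (hrt hy) (hrt hx)
  | succ k ih =>
    intro F _ _ g hg x₀ hx₀
    obtain ⟨C, r, hr, h⟩ := ih (contDiffOn_fderiv hU hg) x₀ hx₀
    obtain ⟨r', hr', hrU⟩ := Metric.isOpen_iff.1 hU x₀ hx₀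
    refine ⟨C, min r r', lt_min hr hr', fun x hx hflat y hy => ?_⟩
    have hsub : segment ℝ x y ⊆ Metric.ball x₀ (min r r') :=
      (convex_ball _ _).segment_subset hx hy
    have key : ∀ z ∈ segment ℝ x y, ‖fderiv ℝ g z‖ ≤ C * ‖y - x‖ ^ (k + 1) := by
      intro z hz
      have h1 := h x (Metric.ball_subset_ball (min_le_left _ _) hx) hflat.2 z
        (Metric.ball_subset_ball (min_le_left _ _) (hsub hz))
      rw [hflat.1, sub_zero] at h1
      refine h1.trans ?_
      gcongr
      rw [← dist_eq_norm, ← dist_eq_norm, dist_comm z x, dist_comm y x]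
      have := dist_add_dist_of_mem_segment hz
      linarith [dist_nonneg (x := z) (y := y)]
    have := (convex_segment x y).norm_image_sub_le_of_norm_hasFDerivWithin_le
      (f := g) (f' := fderiv ℝ g) (fun z hz => (((hg.contDiffAt (hU.mem_nhds (hrU
        (Metric.ball_subset_ball (min_le_right _ _) (hsub hz))))).differentiableAt
          (by simp)).hasFDerivAt).hasFDerivWithinAt) key (left_mem_segment ℝ x y)
        (right_mem_segment ℝ x y)
    rw [pow_succ (n := k + 1), ← mul_assoc]
    exact this

/-- A function all of whose derivatives up to the dimension vanish on `s` maps `s` to a null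
set. -/
theorem volume_image_flat [FiniteDimensional ℝ E] {U : Set E} (hU : IsOpen U) {f : E → ℝ}
    (hf : ContDiffOn ℝ ∞ f U) :
    volume (f '' {x ∈ U | Flat (Module.finrank ℝ E) f x}) = 0 := by
  set n := Module.finrank ℝ E
  -- On the flat set `f` is locally Hölder of exponent `n + 1`, so its image has Hausdorff dimension
  -- at most `n / (n + 1) < 1`.
  have hdim : dimH (f '' {x ∈ U | Flat n f x}) ≤ dimH {x ∈ U | Flat n f x} / ((n + 1 : ℕ) : NNReal) := by
    refine dimH_image_le_of_locally_holder_on (by positivity) fun x₀ hx₀ => ?_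
    obtain ⟨C, r, hr, h⟩ := Flat.norm_sub_le hU n hf x₀ hx₀.1
    refine ⟨C, {x ∈ U | Flat n f x} ∩ Metric.ball x₀ r,
      inter_mem_nhdsWithin _ (Metric.ball_mem_nhds _ hr), ?_⟩
    rintro y hy x hx
    have := h x hx.2 hx.1.2 y hy.2
    rw [edist_dist, edist_dist, dist_eq_norm, dist_eq_norm,
      ENNReal.ofReal_rpow_of_nonneg (norm_nonneg _) (by positivity), ← ENNReal.ofReal_coe_nnreal,
      ← ENNReal.ofReal_mul (by positivity)]
    apply ENNReal.ofReal_le_ofReal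
    change |f y - f x| ≤ C * ‖y - x‖ ^ (((n + 1 : ℕ) : NNReal) : ℝ)
    rw [NNReal.coe_natCast, Real.rpow_natCast]
    exact this
  have hlt : dimH (f '' {x ∈ U | Flat n f x}) < ((1 : NNReal) : ℝ≥0∞) := by
    refine hdim.trans_lt ?_
    have h1 : dimH {x ∈ U | Flat n f x} ≤ (n : ℝ≥0∞) :=
      (dimH_mono (subset_univ _)).trans_eq (Real.dimH_univ_eq_finrank E)
    refine (ENNReal.div_le_div_right h1 _).trans_lt ?_
    rw [ENNReal.coe_one, ENNReal.div_lt_iff (by simp) (by simp)]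
    simp only [ENNReal.coe_natCast, one_mul]
    exact_mod_cast Nat.lt_succ_self n
  have := hausdorffMeasure_of_dimH_lt hlt
  rwa [NNReal.coe_one, MeasureTheory.hausdorffMeasure_real] at this

/-- Some scalar component of the `k`-th derivative of `G` has nonzero differential at `x`. It
vanishes wherever `G` and its first `k` derivatives do, so those points lie, near `x`, on the smooth
hypersurface `g = 0`. -/
theorem Flat.exists_submersion {U : Set E} (hU : IsOpen U) (k : ℕ) :
    ∀ {F : Type} [NormedAddCommGroup F] [NormedSpace ℝ F] {G : E → F},
    ContDiffOn ℝ ∞ G U → ∀ x ∈ U, Flat k G x → ¬ Flat (k + 1) G x → G x = 0 →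
      ∃ g : E → ℝ, ContDiffOn ℝ ∞ g U ∧ fderiv ℝ g x ≠ 0 ∧
        ∀ y, Flat k G y → G y = 0 → g y = 0 := by
  induction k with
  | zero =>
    intro F _ _ G hG x hx _ hn _
    have hne : fderiv ℝ G x ≠ 0 := fun h => hn ⟨h, trivial⟩
    obtain ⟨v, hv⟩ : ∃ v, fderiv ℝ G x v ≠ 0 := by
      by_contra! h
      exact hne (ContinuousLinearMap.ext h)
    obtain ⟨ℓ, -, hℓ⟩ := exists_dual_vector ℝ _ (norm_ne_zero_iff.2 hv)
    refine ⟨fun y => ℓ (G y), ℓ.contDiff.comp_contDiffOn hG, fun h => ?_, fun y _ hy => by simp [hy]⟩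
    have hd : HasFDerivAt (fun y => ℓ (G y)) (ℓ.comp (fderiv ℝ G x)) x :=
      ℓ.hasFDerivAt.comp x ((hG.contDiffAt (hU.mem_nhds hx)).differentiableAt (by simp)).hasFDerivAt
    rw [hd.fderiv] at h
    have := congrArg (fun T : E →L[ℝ] ℝ => T v) h
    simp only [ContinuousLinearMap.comp_apply, hℓ] at this
    simp at this
    exact hv this
  | succ k ih =>
    intro F _ _ G hG x hx hflat hn hGx
    obtain ⟨g, hg, hgx, h⟩ := ih (contDiffOn_fderiv hU hG) x hx hflat.2
      (fun h => hn ⟨hflat.1, h⟩) hflat.1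
    exact ⟨g, hg, hgx, fun y hy _ => h y hy.2 hy.1⟩

/-- If `f '' s` is locally null then it is null. -/
theorem volume_image_eq_zero_of_locally {X : Type*} [TopologicalSpace X]
    [SecondCountableTopology X] {f : X → ℝ} {s : Set X}
    (h : ∀ x ∈ s, ∃ t ∈ 𝓝[s] x, volume (f '' t) = 0) : volume (f '' s) = 0 := by
  choose! t ht h0 using h
  obtain ⟨u, hus, huc, hu⟩ := TopologicalSpace.countable_cover_nhdsWithin ht
  refine measure_mono_null (image_mono hu) ?_
  rw [image_iUnion₂]
  exact (measure_biUnion_null_iff huc).2 fun x hx => h0 x (hus hx)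

/-- **Sard's theorem** for smooth real functions. -/
theorem volume_critical_values (n : ℕ) : ∀ {U : Set (EuclideanSpace ℝ (Fin n))}, IsOpen U →
    ∀ {f : EuclideanSpace ℝ (Fin n) → ℝ}, ContDiffOn ℝ ∞ f U →
    volume (f '' {x ∈ U | fderiv ℝ f x = 0}) = 0 := by
  induction n with
  | zero =>
    intro U _ f _
    exact ((Set.subsingleton_of_subsingleton (s := {x ∈ U | fderiv ℝ f x = 0})).image f).measure_zero _
  | succ d ih =>
    intro U hU f hf
    -- Points where the order of vanishing is exactly `k + 1` lie locally in a hypersurface. They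
    -- remain critical for the restriction of `f` to it, so the induction hypothesis in one
    -- dimension less applies.
    have hloc : ∀ k, volume (f '' {x ∈ U | Flat (k + 1) f x ∧ ¬ Flat (k + 2) f x}) = 0 := by
      intro k
      refine volume_image_eq_zero_of_locally fun x hx => ?_
      obtain ⟨g, hg, hgx, hg0⟩ := Flat.exists_submersion hU k (contDiffOn_fderiv hU hf) x hx.1
        hx.2.1.2 (fun h => hx.2.2 ⟨hx.2.1.1, h⟩) hx.2.1.1
      obtain ⟨φ, hxφ, hφU, hφ, hφs, hφ0⟩ := exists_straightening hU hg hx.1 hgx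
      refine ⟨{x ∈ U | Flat (k + 1) f x ∧ ¬ Flat (k + 2) f x} ∩ φ.source,
        inter_mem_nhdsWithin _ (φ.open_source.mem_nhds hxφ), ?_⟩
      have hV : IsOpen (sliceL d ⁻¹' φ.target) := φ.open_target.preimage (sliceL d).continuous
      have hψ : ContDiffOn ℝ ∞ (fun y => φ.symm (sliceL d y)) (sliceL d ⁻¹' φ.target) :=
        hφs.comp (sliceL d).contDiff.contDiffOn fun y hy => hy
      have hfψ : ContDiffOn ℝ ∞ (fun y => f (φ.symm (sliceL d y))) (sliceL d ⁻¹' φ.target) :=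
        hf.comp hψ fun y hy => hφU (φ.map_target hy)
      refine measure_mono_null ?_ (ih hV hfψ)
      rintro _ ⟨z, ⟨⟨hzU, hz1, -⟩, hzφ⟩, rfl⟩
      have hgz : φ z 0 = 0 := by rw [hφ0]; exact hg0 z hz1.2 hz1.1
      let y : EuclideanSpace ℝ (Fin d) := WithLp.toLp 2 fun i => φ z i.succ
      have hy : sliceL d y = φ z := by
        ext j
        change slicePoint y j = φ z j
        refine Fin.cases ?_ (fun j => ?_) j
        · simp [slicePoint, hgz]
        · simp [slicePoint, y]
      have hyt : y ∈ sliceL d ⁻¹' φ.target := by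
        rw [mem_preimage, hy]
        exact φ.map_source hzφ
      have hyz : φ.symm (sliceL d y) = z := by rw [hy]; exact φ.left_inv hzφ
      refine ⟨y, ⟨hyt, ?_⟩, by simp only [hyz]⟩
      have h1 : HasFDerivAt (fun y => φ.symm (sliceL d y)) (fderiv ℝ (fun y => φ.symm (sliceL d y)) y) y :=
        ((hψ.contDiffAt (hV.mem_nhds hyt)).differentiableAt (by simp)).hasFDerivAt
      have h2 : HasFDerivAt f (0 : Model d →L[ℝ] ℝ) (φ.symm (sliceL d y)) := by
        have := ((hf.contDiffAt (hU.mem_nhds hzU)).differentiableAt (by simp)).hasFDerivAt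
        rw [hz1.1] at this
        rwa [hyz]
      have := (h2.comp y h1).fderiv
      rw [ContinuousLinearMap.zero_comp] at this
      exact this
    have hlast := volume_image_flat hU hf
    refine measure_mono_null ?_ (measure_union_null (measure_iUnion_null hloc) hlast)
    rintro _ ⟨x, ⟨hxU, hx⟩, rfl⟩
    -- A critical point is either flat up to the order of the dimension or has a first nonvanishing
    -- derivative at some finite order.
    by_cases h : Flat (Module.finrank ℝ (EuclideanSpace ℝ (Fin (d + 1)))) f x
    · exact Or.inr ⟨x, ⟨hxU, h⟩, rfl⟩
    · left
      obtain ⟨k, hk⟩ : ∃ k, Flat (k + 1) f x ∧ ¬ Flat (k + 2) f x := by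
        by_contra! hcon
        have : ∀ k, Flat (k + 1) f x := by
          intro k
          induction k with
          | zero => exact ⟨hx, trivial⟩
          | succ k ihk => exact hcon k ihk
        apply h
        rw [finrank_euclideanSpace_fin]
        exact this d
      exact mem_iUnion.2 ⟨k, x, ⟨hxU, hk⟩, rfl⟩

end Sard

/-! ### Minkowski norms, duality and normals -/

/-- A Minkowski norm on the model space. -/
structure IsMinkowski {d : ℕ} (N : Model d → ℝ) : Prop where
  nonneg : ∀ v, 0 ≤ N v
  smooth : ContDiffOn ℝ ∞ N {0}ᶜ
  homogeneous : ∀ (c : ℝ) (v : Model d), 0 ≤ c → N (c • v) = c * N v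
  convex : ∀ v w : Model d, v ≠ 0 → w ≠ 0 →
    0 < (1 / 2 : ℝ) * fderiv ℝ (fderiv ℝ (fun u : Model d => N u ^ 2)) v w w

namespace IsMinkowski

variable {d : ℕ} {N : Model d → ℝ} (hN : IsMinkowski N)
include hN

theorem map_zero : N 0 = 0 := by
  simpa using hN.homogeneous 0 0 le_rfl

theorem smooth_sq : ContDiffOn ℝ ∞ (fun u => N u ^ 2) {0}ᶜ := hN.smooth.pow 2

theorem hasFDerivAt_sq {v : Model d} (hv : v ≠ 0) :
    HasFDerivAt (fun u => N u ^ 2) (fderiv ℝ (fun u => N u ^ 2) v) v :=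
  ((hN.smooth_sq.contDiffAt (isOpen_compl_singleton.mem_nhds hv)).differentiableAt
    (by simp)).hasFDerivAt

theorem fderiv_sq_smul {c : ℝ} (hc : 0 < c) {v : Model d} (hv : v ≠ 0) :
    fderiv ℝ (fun u => N u ^ 2) (c • v) = c • fderiv ℝ (fun u => N u ^ 2) v := by
  have h1 : HasFDerivAt (fun u => N (c • u) ^ 2)
      (c • fderiv ℝ (fun u => N u ^ 2) (c • v)) v := by
    have := (hN.hasFDerivAt_sq (smul_ne_zero hc.ne' hv)).comp v
      ((hasFDerivAt_id v).const_smul c)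
    convert! this using 1
    ext w
    simp
  have h2 : HasFDerivAt (fun u => N (c • u) ^ 2)
      ((c ^ 2) • fderiv ℝ (fun u => N u ^ 2) v) v := by
    have := (hN.hasFDerivAt_sq hv).const_smul (c ^ 2)
    convert! this using 1
    ext u
    simp [hN.homogeneous c u hc.le, mul_pow]
  have := h1.unique h2
  rw [pow_two, mul_smul] at this
  exact smul_right_injective _ hc.ne' this

/-- Euler's identity for the differential of `N²`, which is positively homogeneous of degree one:
differentiate along the ray through `v`. -/
theorem hessian_sq_self {v : Model d} (hv : v ≠ 0) :
    fderiv ℝ (fderiv ℝ (fun u => N u ^ 2)) v v = fderiv ℝ (fun u => N u ^ 2) v := by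
  have hD : HasFDerivAt (fderiv ℝ (fun u => N u ^ 2))
      (fderiv ℝ (fderiv ℝ (fun u => N u ^ 2)) v) ((1 : ℝ) • v) := by
    rw [one_smul]
    have := contDiffOn_fderiv isOpen_compl_singleton hN.smooth_sq
    exact ((this.contDiffAt (isOpen_compl_singleton.mem_nhds hv)).differentiableAt
      (by simp)).hasFDerivAt
  have h1 := hD.comp_hasDerivAt (1 : ℝ) ((hasDerivAt_id (1 : ℝ)).smul_const v)
  have h2 : HasDerivAt (fun c : ℝ => c • fderiv ℝ (fun u => N u ^ 2) v)
      ((1 : ℝ) • fderiv ℝ (fun u => N u ^ 2) v) 1 :=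
    (hasDerivAt_id' (1 : ℝ)).smul_const (fderiv ℝ (fun u => N u ^ 2) v)
  have h3 := h2.congr_of_eventuallyEq
    (f₁ := fun c : ℝ => fderiv ℝ (fun u => N u ^ 2) (c • v)) (by
      filter_upwards [lt_mem_nhds (zero_lt_one (α := ℝ))] with c hc
      exact hN.fderiv_sq_smul hc hv)
  have := h1.unique h3
  simpa using this

theorem fderiv_sq_self {v : Model d} (hv : v ≠ 0) :
    fderiv ℝ (fun u => N u ^ 2) v v = 2 * N v ^ 2 := by
  have hD : HasFDerivAt (fun u => N u ^ 2) (fderiv ℝ (fun u => N u ^ 2) v) ((1 : ℝ) • v) := by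
    rw [one_smul]
    exact hN.hasFDerivAt_sq hv
  have h1 := hD.comp_hasDerivAt (1 : ℝ) ((hasDerivAt_id (1 : ℝ)).smul_const v)
  have h2 : HasDerivAt (fun c : ℝ => c ^ 2 * N v ^ 2) (2 * N v ^ 2) 1 := by
    simpa using (hasDerivAt_pow 2 (1 : ℝ)).mul_const (N v ^ 2)
  have h3 := h2.congr_of_eventuallyEq (f₁ := fun c : ℝ => N (c • v) ^ 2) (by
      filter_upwards [lt_mem_nhds (zero_lt_one (α := ℝ))] with c hc
      simp [hN.homogeneous c v (le_of_lt hc), mul_pow])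
  simpa using h1.unique h3

theorem hessian_self {v : Model d} (hv : v ≠ 0) :
    (1 / 2 : ℝ) * fderiv ℝ (fderiv ℝ (fun u => N u ^ 2)) v v v = N v ^ 2 := by
  rw [hN.hessian_sq_self hv, hN.fderiv_sq_self hv]
  ring

/-- Definiteness is not part of the definition. It follows from strong convexity because `g_v(v, v)
= N(v)²`. -/
theorem pos {v : Model d} (hv : v ≠ 0) : 0 < N v := by
  have h := hN.convex v v hv hv
  rw [hN.hessian_self hv] at h
  exact (hN.nonneg v).lt_of_ne fun h0 => by simp [← h0] at h

theorem le_mul_norm : ∃ C, ∀ v, N v ≤ C * ‖v‖ := by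
  obtain ⟨C, hC⟩ := (isCompact_sphere (0 : Model d) 1).bddAbove_image
    (hN.smooth.continuousOn.mono fun v hv h0 => by
      rw [mem_singleton_iff] at h0; simp [h0] at hv)
  refine ⟨C, fun v => ?_⟩
  rcases eq_or_ne v 0 with rfl | hv
  · simp [hN.map_zero]
  have h1 : N (‖v‖⁻¹ • v) ≤ C := hC ⟨_, by simp [norm_smul, hv], rfl⟩
  rw [hN.homogeneous _ _ (by positivity), inv_mul_le_iff₀ (by positivity)] at h1
  linarith

theorem mul_norm_le : ∃ c > 0, ∀ v, c * ‖v‖ ≤ N v := by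
  obtain ⟨u, hu, hmin⟩ := (isCompact_sphere (0 : Model d) 1).exists_isMinOn
    (NormedSpace.sphere_nonempty.2 zero_le_one) (hN.smooth.continuousOn.mono fun v hv h0 => by
      rw [mem_singleton_iff] at h0; simp [h0] at hv)
  have hu0 : u ≠ 0 := fun h => by simp [h] at hu
  refine ⟨N u, hN.pos hu0, fun v => ?_⟩
  rcases eq_or_ne v 0 with rfl | hv
  · simp [hN.map_zero]
  have h1 : N u ≤ N (‖v‖⁻¹ • v) := hmin (by simp [norm_smul, hv])
  rw [hN.homogeneous _ _ (by positivity), inv_mul_eq_div, le_div_iff₀ (by positivity)] at h1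
  exact h1

theorem continuous : Continuous N := by
  rw [continuous_iff_continuousAt]
  intro v
  rcases eq_or_ne v 0 with rfl | hv
  · obtain ⟨C, hC⟩ := hN.le_mul_norm
    rw [ContinuousAt, hN.map_zero]
    refine squeeze_zero hN.nonneg hC ?_
    have : Continuous fun v : Model d => C * ‖v‖ := by fun_prop
    simpa using this.tendsto 0
  · exact hN.smooth.continuousOn.continuousAt (isOpen_compl_singleton.mem_nhds hv)

theorem isCompact_unitBall : IsCompact {v | N v ≤ 1} := by
  obtain ⟨c, hc, h⟩ := hN.mul_norm_le
  refine Metric.isCompact_of_isClosed_isBounded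
    (isClosed_le hN.continuous continuous_const) ?_
  refine (Metric.isBounded_closedBall (x := (0 : Model d)) (r := 1 / c)).subset fun v hv => ?_
  rw [mem_closedBall_zero_iff, le_div_iff₀ hc, mul_comm]
  exact (h v).trans hv

theorem bddAbove_dual (α : Model d →L[ℝ] ℝ) : BddAbove {r : ℝ | ∃ v, N v ≤ 1 ∧ α v = r} := by
  exact hN.isCompact_unitBall.bddAbove_image α.continuous.continuousOn

theorem dual_nonneg (α : Model d →L[ℝ] ℝ) : 0 ≤ sSup {r : ℝ | ∃ v, N v ≤ 1 ∧ α v = r} :=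
  le_csSup (hN.bddAbove_dual α) ⟨0, by simp [hN.map_zero], by simp⟩

theorem apply_le_dual_mul (α : Model d →L[ℝ] ℝ) (v : Model d) :
    α v ≤ sSup {r : ℝ | ∃ v, N v ≤ 1 ∧ α v = r} * N v := by
  rcases eq_or_ne v 0 with rfl | hv
  · simp [hN.map_zero]
  have hp := hN.pos hv
  have : (N v)⁻¹ * α v ≤ sSup {r : ℝ | ∃ v, N v ≤ 1 ∧ α v = r} := by
    refine le_csSup (hN.bddAbove_dual α) ⟨(N v)⁻¹ • v, ?_, by simp⟩
    rw [hN.homogeneous _ _ (by positivity), inv_mul_cancel₀ hp.ne']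
  rwa [inv_mul_le_iff₀ hp, mul_comm] at this

theorem dual_add_le (α β : Model d →L[ℝ] ℝ) :
    sSup {r : ℝ | ∃ v, N v ≤ 1 ∧ (α + β) v = r} ≤
      sSup {r : ℝ | ∃ v, N v ≤ 1 ∧ α v = r} + sSup {r : ℝ | ∃ v, N v ≤ 1 ∧ β v = r} := by
  refine csSup_le ⟨0, 0, by simp [hN.map_zero], by simp⟩ ?_
  rintro _ ⟨v, hv, rfl⟩
  exact add_le_add (le_csSup (hN.bddAbove_dual α) ⟨v, hv, rfl⟩)
    (le_csSup (hN.bddAbove_dual β) ⟨v, hv, rfl⟩)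

/-- If `u` maximizes `α` on the unit ball and `D = α u` is the dual norm, then `D • u` has value at
least `D²/2`. No `w` exceeds this, since `α w - N(w)²/2 ≤ D N(w) - N(w)²/2 ≤ D²/2`. -/
theorem exists_legendre (α : Model d →L[ℝ] ℝ) : ∃ v : Model d,
    ∀ w, α w - (1 / 2 : ℝ) * N w ^ 2 ≤ α v - (1 / 2 : ℝ) * N v ^ 2 := by
  set D := sSup {r : ℝ | ∃ v, N v ≤ 1 ∧ α v = r} with hD
  have hne : {v | N v ≤ 1}.Nonempty := ⟨0, by simp [hN.map_zero]⟩
  obtain ⟨u, hu, hmax⟩ := hN.isCompact_unitBall.exists_isMaxOn hne α.continuous.continuousOn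
  have hDu : D = α u := by
    refine le_antisymm (csSup_le ⟨0, 0, by simp [hN.map_zero], by simp⟩ ?_)
      (le_csSup (hN.bddAbove_dual α) ⟨u, hu, rfl⟩)
    rintro _ ⟨v, hv, rfl⟩
    exact hmax hv
  have hD0 : 0 ≤ D := hN.dual_nonneg α
  refine ⟨D • u, fun w => ?_⟩
  have h1 := hN.apply_le_dual_mul α w
  rw [← hD] at h1
  rw [hN.homogeneous _ _ hD0, map_smul, smul_eq_mul, ← hDu]
  have h2 : N u ^ 2 ≤ 1 := pow_le_one₀ (hN.nonneg u) hu
  nlinarith [sq_nonneg (D - N w), mul_nonneg (sq_nonneg D) (sub_nonneg.2 h2)]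

/-- The maximal value is at least `D²/2`, while `α v ≤ D N(v)`; together these force `(N(v) - D)² ≤
0`. The argument covers every maximizer, so no uniqueness is needed. -/
theorem norm_eq_dual_of_isMax {α : Model d →L[ℝ] ℝ} {v : Model d}
    (hv : ∀ w, α w - (1 / 2 : ℝ) * N w ^ 2 ≤ α v - (1 / 2 : ℝ) * N v ^ 2) :
    N v = sSup {r : ℝ | ∃ v, N v ≤ 1 ∧ α v = r} := by
  set D := sSup {r : ℝ | ∃ v, N v ≤ 1 ∧ α v = r} with hD
  have h1 := hN.apply_le_dual_mul α v
  rw [← hD] at h1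
  have hle : D ^ 2 / 2 ≤ α v - (1 / 2 : ℝ) * N v ^ 2 := by
    have hne : {v | N v ≤ 1}.Nonempty := ⟨0, by simp [hN.map_zero]⟩
    obtain ⟨u, hu, hmax⟩ := hN.isCompact_unitBall.exists_isMaxOn hne α.continuous.continuousOn
    have hDu : D = α u := by
      refine le_antisymm (csSup_le ⟨0, 0, by simp [hN.map_zero], by simp⟩ ?_)
        (le_csSup (hN.bddAbove_dual α) ⟨u, hu, rfl⟩)
      rintro _ ⟨v, hv, rfl⟩
      exact hmax hv
    have hD0 : 0 ≤ D := hN.dual_nonneg α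
    have h3 := hv (D • u)
    rw [hN.homogeneous _ _ hD0, map_smul, smul_eq_mul, ← hDu] at h3
    have h2 : N u ^ 2 ≤ 1 := pow_le_one₀ (hN.nonneg u) hu
    nlinarith [mul_nonneg (sq_nonneg D) (sub_nonneg.2 h2)]
  have h4 : (N v - D) ^ 2 ≤ 0 := by nlinarith
  have h5 : N v - D = 0 := by
    rw [← sq_eq_zero_iff]; exact le_antisymm h4 (sq_nonneg _)
  linarith

/-- The unit normal of a hyperplane `ker α`, on the positive side of `α`. -/
theorem exists_normal {α : Model d →L[ℝ] ℝ} (hα : α ≠ 0) : ∃ n : Model d, N n = 1 ∧ 0 < α n ∧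
    ∀ w, α w = 0 → (1 / 2 : ℝ) * fderiv ℝ (fderiv ℝ (fun u => N u ^ 2)) n n w = 0 := by
  obtain ⟨v, hv⟩ := hN.exists_legendre α
  have hvD := hN.norm_eq_dual_of_isMax hv
  have hv0 : v ≠ 0 := by
    rintro rfl
    rw [hN.map_zero] at hvD
    apply hα
    have hle : ∀ w, α w ≤ 0 := fun w => by
      have := hN.apply_le_dual_mul α w
      rwa [← hvD, zero_mul] at this
    ext w
    refine le_antisymm (hle w) ?_
    have := hle (-w)
    rw [map_neg] at this
    change 0 ≤ α w
    linarith
  have hp := hN.pos hv0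
  -- The first-order condition at the Legendre transform `v` of `α`. By Euler's identity the
  -- right-hand side is `g_v(v, ·)`, so `v` is orthogonal to `ker α` and only has to be normalized.
  have hfd : α = (1 / 2 : ℝ) • fderiv ℝ (fun u => N u ^ 2) v := by
    have hmax : IsLocalMax (fun w => α w - (1 / 2 : ℝ) * N w ^ 2) v := Eventually.of_forall hv
    have hd := α.hasFDerivAt (x := v) |>.sub ((hN.hasFDerivAt_sq hv0).const_mul (1 / 2 : ℝ))
    exact sub_eq_zero.1 (hmax.hasFDerivAt_eq_zero hd)
  have hvv : α v = N v ^ 2 := by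
    rw [hfd, smul_apply, hN.fderiv_sq_self hv0, smul_eq_mul]
    ring
  have hn0 : (N v)⁻¹ • v ≠ 0 := smul_ne_zero (by positivity) hv0
  refine ⟨(N v)⁻¹ • v, ?_, ?_, fun w hw => ?_⟩
  · rw [hN.homogeneous _ _ (by positivity), inv_mul_cancel₀ hp.ne']
  · rw [map_smul, hvv, smul_eq_mul]
    positivity
  · rw [hN.hessian_sq_self hn0, hN.fderiv_sq_smul (by positivity) hv0]
    have : (1 / 2 : ℝ) * fderiv ℝ (fun u => N u ^ 2) v w = 0 := by
      rw [hfd] at hw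
      exact hw
    rw [smul_apply, smul_eq_mul]
    linear_combination (N v)⁻¹ * this

end IsMinkowski

/-! ### The Finsler metric fibre by fibre -/

section Tangent

variable {d : ℕ} {M : Type*} [TopologicalSpace M] [ChartedSpace (Model d) M]
  [IsManifold (𝓡 (d + 1)) ∞ M]

theorem contMDiff_fiber (x : M) : ContMDiff 𝓘(ℝ, Model d) (𝓡 (d + 1)).tangent ∞
    (fun v : Model d => (⟨x, v⟩ : TangentBundle (𝓡 (d + 1)) M)) := by
  intro v
  rw [Bundle.contMDiffAt_totalSpace]
  refine ⟨contMDiffAt_const, ?_⟩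
  have : (fun v : Model d => (trivializationAt (Model d) (TangentSpace (𝓡 (d + 1))) x
      (⟨x, v⟩ : TangentBundle (𝓡 (d + 1)) M)).2) =
      fun v : Model d => (trivializationAt (Model d) (TangentSpace (𝓡 (d + 1))) x).continuousLinearMapAt ℝ x
        (show TangentSpace (𝓡 (d + 1)) x from v) := by
    ext1 v
    rw [Bundle.Trivialization.continuousLinearMapAt_apply_of_mem _ _ (by simp)]
  rw [this]
  exact (ContinuousLinearMap.contMDiff (𝕜 := ℝ) (E := Model d) (F := Model d) _).contMDiffAt

theorem Metric.isMinkowski (F : Metric d M) (x : M) :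
    IsMinkowski (d := d) (fun v : Model d => F.toFun x v) where
  nonneg := F.nonneg x
  smooth := by
    rw [← contMDiffOn_iff_contDiffOn]
    exact F.smooth.comp (contMDiff_fiber x).contMDiffOn fun v hv => hv
  homogeneous := F.homogeneous x
  convex := F.strongly_convex x

/-- Replaces `F(∇f)` by `F*(df)` in the energy. Any maximizer has the right norm, so the choice made
by `Classical.epsilon` is harmless. -/
theorem Metric.toFun_legendre (F : Metric d M) (x : M)
    (α : TangentSpace (𝓡 (d + 1)) x →L[ℝ] ℝ) : F.toFun x (F.legendre x α) = F.dual x α :=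
  (F.isMinkowski x).norm_eq_dual_of_isMax
    (Classical.epsilon_spec ((F.isMinkowski x).exists_legendre α))

theorem Metric.dual_nonneg (F : Metric d M) (x : M)
    (α : TangentSpace (𝓡 (d + 1)) x →L[ℝ] ℝ) : 0 ≤ F.dual x α :=
  (F.isMinkowski x).dual_nonneg α

theorem Metric.dual_add_le (F : Metric d M) (x : M)
    (α β : TangentSpace (𝓡 (d + 1)) x →L[ℝ] ℝ) :
    F.dual x (α + β) ≤ F.dual x α + F.dual x β :=
  (F.isMinkowski x).dual_add_le α β

theorem Metric.apply_le_dual_mul (F : Metric d M) (x : M)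
    (α : TangentSpace (𝓡 (d + 1)) x →L[ℝ] ℝ) (v : TangentSpace (𝓡 (d + 1)) x) :
    α v ≤ F.dual x α * F.toFun x v :=
  (F.isMinkowski x).apply_le_dual_mul α v

/-- Test the supremum with `w = v`: the quotient is then `1` by Euler's identity. -/
theorem Metric.one_le_concavity [Nonempty M] (F : Metric d M) : 1 ≤ F.concavity := by
  obtain ⟨x⟩ := ‹Nonempty M›
  obtain ⟨v, hv⟩ := exists_ne (0 : Model d)
  have hp := (F.isMinkowski x).pos hv
  have h1 : F.fundamental x v v v / (F.toFun x v) ^ 2 = 1 := by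
    have := (F.isMinkowski x).hessian_self hv
    refine (congrArg (fun r => r / (F.toFun x v) ^ 2) this).trans (div_self (by positivity))
  calc (1 : ℝ≥0∞) = ENNReal.ofReal (F.fundamental x v v v / (F.toFun x v) ^ 2) := by simp [h1]
    _ ≤ F.concavity := by
      unfold Metric.concavity
      exact le_iSup_of_le x (le_iSup_of_le v (le_iSup_of_le v (le_iSup₂_of_le hv hv le_rfl)))

end Tangent

/-! ### Differentials and changes of charts -/

section ChartCalculus

variable {d : ℕ} {M : Type*} [TopologicalSpace M] [ChartedSpace (Model d) M]
  [IsManifold (𝓡 (d + 1)) ∞ M]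

theorem isChart_chartAt (x : M) : IsChart (chartAt (Model d) x) :=
  IsManifold.chart_mem_maximalAtlas x

theorem contDiffAt_comp_symm {e : OpenPartialHomeomorph M (Model d)} (he : IsChart e) {x : M}
    (hx : x ∈ e.source) {E' : Type*} [NormedAddCommGroup E'] [NormedSpace ℝ E'] {f : M → E'}
    (hf : ContMDiffAt (𝓡 (d + 1)) 𝓘(ℝ, E') ∞ f x) :
    ContDiffAt ℝ ∞ (f ∘ e.symm) (e x) := by
  rw [← contMDiffAt_iff_contDiffAt]
  refine ContMDiffAt.comp (I' := 𝓡 (d + 1)) (e x) ?_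
    (contMDiffAt_symm_of_mem_maximalAtlas he (e.map_source hx))
  rwa [e.left_inv hx]

theorem differentiableAt_comp_symm {e : OpenPartialHomeomorph M (Model d)} (he : IsChart e) {x : M}
    (hx : x ∈ e.source) {E' : Type*} [NormedAddCommGroup E'] [NormedSpace ℝ E'] {f : M → E'}
    (hf : ContMDiffAt (𝓡 (d + 1)) 𝓘(ℝ, E') ∞ f x) :
    DifferentiableAt ℝ (f ∘ e.symm) (e x) :=
  (contDiffAt_comp_symm he hx hf).differentiableAt (by simp)

theorem contMDiffAt_chart {e : OpenPartialHomeomorph M (Model d)} (he : IsChart e) {x : M}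
    (hx : x ∈ e.source) : ContMDiffAt (𝓡 (d + 1)) 𝓘(ℝ, Model d) ∞ e x :=
  contMDiffAt_of_mem_maximalAtlas he hx

theorem contMDiffAt_chart_zero {e : OpenPartialHomeomorph M (Model d)} (he : IsChart e) {x : M}
    (hx : x ∈ e.source) : ContMDiffAt (𝓡 (d + 1)) 𝓘(ℝ, ℝ) ∞ (fun z => e z 0) x :=
  (EuclideanSpace.proj (𝕜 := ℝ) (0 : Fin (d + 1))).contMDiff.contMDiffAt.comp x
    (contMDiffAt_chart he hx)

/-- The chain rule for a change of charts. -/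
theorem fderiv_comp_symm_change {e e' : OpenPartialHomeomorph M (Model d)} (he : IsChart e)
    (he' : IsChart e') {x : M} (hx : x ∈ e.source) (hx' : x ∈ e'.source)
    {E' : Type*} [NormedAddCommGroup E'] [NormedSpace ℝ E'] {f : M → E'}
    (hf : ContMDiffAt (𝓡 (d + 1)) 𝓘(ℝ, E') ∞ f x) :
    fderiv ℝ (f ∘ e'.symm) (e' x) =
      (fderiv ℝ (f ∘ e.symm) (e x)).comp (fderiv ℝ (e ∘ e'.symm) (e' x)) := by
  have h1 := (differentiableAt_comp_symm he' hx' (contMDiffAt_chart he hx)).hasFDerivAt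
  have h2 := (differentiableAt_comp_symm he hx hf).hasFDerivAt
  have h2' : HasFDerivAt (f ∘ e.symm) (fderiv ℝ (f ∘ e.symm) (e x)) ((e ∘ e'.symm) (e' x)) := by
    simpa [e'.left_inv hx'] using h2
  refine ((h2'.comp (e' x) h1).congr_of_eventuallyEq ?_).fderiv
  have hs : e'.target ∩ e'.symm ⁻¹' e.source ∈ 𝓝 (e' x) :=
    (e'.isOpen_inter_preimage_symm e.open_source).mem_nhds
      ⟨e'.map_source hx', by simpa [e'.left_inv hx'] using hx⟩
  filter_upwards [hs] with z hz
  simp [e.left_inv hz.2]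

theorem differential_eq {f : M → ℝ} {x : M} (hf : ContMDiffAt (𝓡 (d + 1)) 𝓘(ℝ, ℝ) ∞ f x) :
    differential f x = fderiv ℝ (f ∘ (chartAt (Model d) x).symm) (chartAt (Model d) x x) := by
  refine (hf.mdifferentiableAt (by simp)).mfderiv.trans ?_
  simp [writtenInExtChartAt, extChartAt]
  rfl

theorem differential_eq_comp {e : OpenPartialHomeomorph M (Model d)} (he : IsChart e) {x : M}
    (hx : x ∈ e.source) {f : M → ℝ} (hf : ContMDiffAt (𝓡 (d + 1)) 𝓘(ℝ, ℝ) ∞ f x) :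
    differential f x = (fderiv ℝ (f ∘ e.symm) (e x)).comp
      (fderiv ℝ (e ∘ (chartAt (Model d) x).symm) (chartAt (Model d) x x)) := by
  rw [differential_eq hf]
  exact fderiv_comp_symm_change he (isChart_chartAt x) hx (mem_chart_source _ x) hf

theorem fderiv_change_comp_self {e e' : OpenPartialHomeomorph M (Model d)} (he : IsChart e)
    (he' : IsChart e') {x : M} (hx : x ∈ e.source) (hx' : x ∈ e'.source) :
    (fderiv ℝ (e ∘ e'.symm) (e' x)).comp (fderiv ℝ (e' ∘ e.symm) (e x)) =
      ContinuousLinearMap.id ℝ (Model d) := by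
  rw [← fderiv_comp_symm_change he' he hx' hx (contMDiffAt_chart he hx)]
  have : (e ∘ e.symm : Model d → Model d) =ᶠ[𝓝 (e x)] id := by
    filter_upwards [e.open_target.mem_nhds (e.map_source hx)] with z hz
    exact e.right_inv hz
  rw [this.fderiv_eq, fderiv_id]

theorem tangentCoordChange_eq {x₀ x : M} :
    tangentCoordChange (𝓡 (d + 1)) x₀ x x =
      fderiv ℝ (chartAt (Model d) x ∘ (chartAt (Model d) x₀).symm) (chartAt (Model d) x₀ x) := by
  rw [tangentCoordChange_def]
  simp [extChartAt]

/-- `T_xM` is identified with the model space through the preferred chart at `x`, which may jump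
with `x`. The coordinate change refers covectors to the fixed chart at `x₀`, where a smooth
differential depends continuously on the point. -/
theorem differential_comp_tangentCoordChange {x₀ x : M} (hx : x ∈ (chartAt (Model d) x₀).source)
    {f : M → ℝ} (hf : ContMDiffAt (𝓡 (d + 1)) 𝓘(ℝ, ℝ) ∞ f x) :
    (differential f x : Model d →L[ℝ] ℝ).comp (tangentCoordChange (𝓡 (d + 1)) x₀ x x) =
      fderiv ℝ (f ∘ (chartAt (Model d) x₀).symm) (chartAt (Model d) x₀ x) := by
  rw [tangentCoordChange_eq, differential_eq hf]
  exact (fderiv_comp_symm_change (isChart_chartAt x) (isChart_chartAt x₀) (mem_chart_source _ x)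
    hx hf).symm

theorem tangentCoordChange_surjective {x₀ x : M} (hx : x ∈ (chartAt (Model d) x₀).source) :
    Function.Surjective (tangentCoordChange (𝓡 (d + 1)) x₀ x x) := by
  intro v
  refine ⟨fderiv ℝ (chartAt (Model d) x₀ ∘ (chartAt (Model d) x).symm) (chartAt (Model d) x x) v, ?_⟩
  rw [tangentCoordChange_eq]
  exact congrArg (fun T : Model d →L[ℝ] Model d => T v)
    (fderiv_change_comp_self (isChart_chartAt x) (isChart_chartAt x₀) (mem_chart_source _ x) hx)

theorem tangentCoordChange_ne_zero {x₀ x : M} (hx : x ∈ (chartAt (Model d) x₀).source)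
    {w : Model d} (hw : w ≠ 0) : tangentCoordChange (𝓡 (d + 1)) x₀ x x w ≠ 0 :=
  fun h => hw (LinearMap.injective_iff_surjective.2 (tangentCoordChange_surjective hx)
    (h.trans (map_zero _).symm) : w = 0)

end ChartCalculus

/-! ### Measurability of the dual norm -/

section Measurability

/-- By homogeneity the dual norm is the supremum of the quotients `α / N`, and by continuity a dense
set of directions suffices. Vectors mapped to zero contribute `0 / 0 = 0`, and `ENNReal.ofReal`
discards negative quotients. -/
theorem IsMinkowski.ofReal_dual_eq_iSup {d : ℕ} {N : Model d → ℝ} (hN : IsMinkowski N)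
    (α T) (hT : Function.Surjective (T : Model d →L[ℝ] Model d)) {S : Set (Model d)}
    (hS : Dense S) :
    ENNReal.ofReal (sSup {r : ℝ | ∃ v, N v ≤ 1 ∧ (α : Model d →L[ℝ] ℝ) v = r}) =
      ⨆ w : S, ENNReal.ofReal (α (T w) / N (T w)) := by
  refine le_antisymm (le_of_forall_lt fun r hr => ?_) (iSup_le fun w => ?_)
  · have hne : {v | N v ≤ 1}.Nonempty := ⟨0, by simp [hN.map_zero]⟩
    obtain ⟨u, hu, hmax⟩ := hN.isCompact_unitBall.exists_isMaxOn hne α.continuous.continuousOn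
    have hD : sSup {r : ℝ | ∃ v, N v ≤ 1 ∧ α v = r} ≤ α u := by
      refine csSup_le ⟨0, 0, by simp [hN.map_zero], by simp⟩ ?_
      rintro _ ⟨v, hv, rfl⟩
      exact hmax hv
    have hr' : r < ENNReal.ofReal (α u) := hr.trans_le (ENNReal.ofReal_le_ofReal hD)
    have hαu : 0 < α u := ENNReal.ofReal_pos.1 (bot_le.trans_lt hr')
    have hu0 : u ≠ 0 := by rintro rfl; simp at hαu
    have hp := hN.pos hu0
    have hr'' : r < ENNReal.ofReal (α u / N u) := by
      refine hr'.trans_le (ENNReal.ofReal_le_ofReal ?_)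
      rw [le_div_iff₀ hp]
      exact mul_le_of_le_one_right hαu.le hu
    obtain ⟨w, rfl⟩ := hT u
    have hc : ContinuousAt (fun w => ENNReal.ofReal (α (T w) / N (T w))) w := by
      refine ENNReal.continuous_ofReal.continuousAt.comp (ContinuousAt.div ?_ ?_ hp.ne')
      · exact (α.continuous.comp T.continuous).continuousAt
      · exact (hN.continuous.comp T.continuous).continuousAt
    obtain ⟨w', hwS, hw'⟩ := hS.inter_nhds_nonempty (hc.eventually (lt_mem_nhds hr''))
    exact lt_iSup_iff.2 ⟨⟨w', hwS⟩, hw'⟩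
  · refine ENNReal.ofReal_le_ofReal ?_
    have h1 := hN.apply_le_dual_mul α (T w)
    rcases eq_or_ne (T w) 0 with h0 | h0
    · rw [h0, α.map_zero, zero_div]
      exact hN.dual_nonneg α
    · rwa [div_le_iff₀ (hN.pos h0)]

variable {d : ℕ} {M : Type*} [TopologicalSpace M] [ChartedSpace (Model d) M]
  [IsManifold (𝓡 (d + 1)) ∞ M] (F : Metric d M)

theorem Metric.continuousOn_tangentCoordChange (x₀ : M) (w : Model d) :
    ContinuousOn (fun x => F.toFun x (tangentCoordChange (𝓡 (d + 1)) x₀ x x w))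
      (chartAt (Model d) x₀).source := by
  rcases eq_or_ne w 0 with rfl | hw
  · have : (fun x => F.toFun x (tangentCoordChange (𝓡 (d + 1)) x₀ x x (0 : Model d))) =
        fun _ => (0 : ℝ) := by
      ext x
      rw [map_zero]
      exact (F.isMinkowski x).map_zero
    rw [this]
    exact continuousOn_const
  · have hc : ContinuousOn (fun x : M => (⟨x, tangentCoordChange (𝓡 (d + 1)) x₀ x x w⟩ :
        TangentBundle (𝓡 (d + 1)) M)) (chartAt (Model d) x₀).source :=
      (trivializationAt (Model d) (TangentSpace (𝓡 (d + 1))) x₀).toOpenPartialHomeomorph.symm.continuousOn.comp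
        (f := fun x : M => (x, w)) (by fun_prop) fun x hx => by
          simpa using hx
    exact F.smooth.continuousOn.comp hc fun x hx => tangentCoordChange_ne_zero hx hw

theorem Metric.ofReal_dual_eq_iSup {x₀ x : M} (hx : x ∈ (chartAt (Model d) x₀).source)
    (α : TangentSpace (𝓡 (d + 1)) x →L[ℝ] ℝ) {S : Set (Model d)} (hS : Dense S) :
    ENNReal.ofReal (F.dual x α) = ⨆ w : S, ENNReal.ofReal
      (((α : Model d →L[ℝ] ℝ).comp (tangentCoordChange (𝓡 (d + 1)) x₀ x x)) w /
        F.toFun x (tangentCoordChange (𝓡 (d + 1)) x₀ x x w)) :=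
  (F.isMinkowski x).ofReal_dual_eq_iSup α _ (tangentCoordChange_surjective hx) hS

/-- Over each of countably many charts the dual norm is a countable supremum of measurable
quotients, taken over a dense sequence of directions fixed in the chart. -/
theorem Metric.aemeasurable_dual [SecondCountableTopology M] [MeasurableSpace M] [BorelSpace M]
    {μ : Measure M}
    {α : (x : M) → TangentSpace (𝓡 (d + 1)) x →L[ℝ] ℝ} (hα : MeasurableCovectorField μ α) :
    AEMeasurable (fun x => ENNReal.ofReal (F.dual x (α x))) μ := by
  obtain ⟨s, hsc, hs⟩ := TopologicalSpace.countable_cover_nhds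
    (fun x : M => (chartAt (Model d) x).open_source.mem_nhds (mem_chart_source _ x))
  have := hsc.to_subtype
  have hμ : μ = μ.restrict (⋃ x : s, (chartAt (Model d) (x : M)).source) := by
    rw [iUnion_coe_set, hs, Measure.restrict_univ]
  rw [hμ, aemeasurable_iUnion_iff]
  rintro ⟨x₀, -⟩
  obtain ⟨S, hSc, hS⟩ := TopologicalSpace.exists_countable_dense (Model d)
  have := hSc.to_subtype
  have hm : AEMeasurable (fun x => ⨆ w : S, ENNReal.ofReal
      (((α x : Model d →L[ℝ] ℝ).comp (tangentCoordChange (𝓡 (d + 1)) x₀ x x)) w /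
        F.toFun x (tangentCoordChange (𝓡 (d + 1)) x₀ x x w)))
      (μ.restrict (chartAt (Model d) x₀).source) := by
    refine AEMeasurable.iSup fun w => ENNReal.measurable_ofReal.comp_aemeasurable (.div ?_ ?_)
    · exact (ContinuousLinearMap.measurable_apply (w : Model d)).comp_aemeasurable (hα x₀)
    · exact (F.continuousOn_tangentCoordChange x₀ w).aemeasurable
        (chartAt (Model d) x₀).open_source.measurableSet
  refine hm.congr ?_
  filter_upwards [ae_restrict_mem (chartAt (Model d) x₀).open_source.measurableSet] with x hx
  exact (F.ofReal_dual_eq_iSup hx (α x) hS).symm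

theorem continuousOn_differential_tangentCoordChange {u : M → ℝ}
    (hu : ContMDiff (𝓡 (d + 1)) 𝓘(ℝ, ℝ) ∞ u) (x₀ : M) :
    ContinuousOn (fun x : M => (differential u x : Model d →L[ℝ] ℝ).comp
      (tangentCoordChange (𝓡 (d + 1)) x₀ x x)) (chartAt (Model d) x₀).source := by
  have h1 : ContDiffOn ℝ ∞ (u ∘ (chartAt (Model d) x₀).symm) (chartAt (Model d) x₀).target := by
    intro z hz
    have := contDiffAt_comp_symm (isChart_chartAt x₀) ((chartAt (Model d) x₀).map_target hz)
      (hu.contMDiffAt)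
    rw [(chartAt (Model d) x₀).right_inv hz] at this
    exact this.contDiffWithinAt
  have h2 := (contDiffOn_fderiv (chartAt (Model d) x₀).open_target h1).continuousOn.comp
    (chartAt (Model d) x₀).continuousOn (chartAt (Model d) x₀).mapsTo
  exact h2.congr fun x hx => differential_comp_tangentCoordChange hx hu.contMDiffAt

/-- For smooth `u` the quotients are continuous in `x`, so their supremum is lower semicontinuous.
Only nonzero directions are used, because the quotient must have a nonvanishing denominator. -/
theorem Metric.measurable_dual_differential [MeasurableSpace M] [BorelSpace M]
    {u : M → ℝ} (hu : ContMDiff (𝓡 (d + 1)) 𝓘(ℝ, ℝ) ∞ u) :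
    Measurable (fun x => ENNReal.ofReal (F.dual x (differential u x))) := by
  refine LowerSemicontinuous.measurable fun x₀ => ?_
  have hsrc := (chartAt (Model d) x₀).open_source.mem_nhds (mem_chart_source _ x₀)
  have hl : LowerSemicontinuousAt (fun x => ⨆ w : ({0}ᶜ : Set (Model d)), ENNReal.ofReal
      (((differential u x : Model d →L[ℝ] ℝ).comp (tangentCoordChange (𝓡 (d + 1)) x₀ x x)) w /
        F.toFun x (tangentCoordChange (𝓡 (d + 1)) x₀ x x w))) x₀ := by
    refine lowerSemicontinuousAt_iSup fun w => ContinuousAt.lowerSemicontinuousAt ?_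
    refine ENNReal.continuous_ofReal.continuousAt.comp (ContinuousAt.div ?_ ?_ ?_)
    · exact ((continuousOn_differential_tangentCoordChange hu x₀).continuousAt hsrc).clm_apply
        continuousAt_const
    · exact (F.continuousOn_tangentCoordChange x₀ w).continuousAt hsrc
    · exact ((F.isMinkowski x₀).pos
        (tangentCoordChange_ne_zero (mem_chart_source _ x₀) w.2)).ne'
  intro r hr
  have hr' := hr
  simp only [F.ofReal_dual_eq_iSup (mem_chart_source _ x₀) _ (dense_compl_singleton (0 : Model d))]
    at hr'
  filter_upwards [hl r hr', hsrc] with x hx hxs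
  simp only [F.ofReal_dual_eq_iSup hxs _ (dense_compl_singleton (0 : Model d))]
  exact hx

end Measurability

/-! ### Charts whose zeroth coordinate is a given function -/

section Adapted

variable {d : ℕ} {M : Type*} [TopologicalSpace M] [ChartedSpace (Model d) M]
  [IsManifold (𝓡 (d + 1)) ∞ M]

theorem IsChart.trans {e : OpenPartialHomeomorph M (Model d)} (he : IsChart e)
    {φ : OpenPartialHomeomorph (Model d) (Model d)} (hφ : ContDiffOn ℝ ∞ φ φ.source)
    (hφs : ContDiffOn ℝ ∞ φ.symm φ.target) : IsChart (e ≫ₕ φ) := by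
  refine (e ≫ₕ φ).mem_maximalAtlas_of_contMDiffOn ?_ ?_
  · rw [OpenPartialHomeomorph.trans_source]
    exact (contMDiffOn_iff_contDiffOn.2 hφ).comp
      ((contMDiffOn_of_mem_maximalAtlas he).mono inter_subset_left) fun x hx => hx.2
  · rw [OpenPartialHomeomorph.trans_target]
    exact (contMDiffOn_symm_of_mem_maximalAtlas he).comp
      ((contMDiffOn_iff_contDiffOn.2 hφs).mono inter_subset_left) fun x hx => hx.2

theorem contDiffOn_comp_symm {e : OpenPartialHomeomorph M (Model d)} (he : IsChart e)
    {u : M → ℝ} (hu : ContMDiff (𝓡 (d + 1)) 𝓘(ℝ, ℝ) ∞ u) :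
    ContDiffOn ℝ ∞ (u ∘ e.symm) e.target := fun z hz => by
  have := contDiffAt_comp_symm he (e.map_target hz) hu.contMDiffAt
  rw [e.right_inv hz] at this
  exact this.contDiffWithinAt

/-- Near a regular point, a smooth function is the zeroth coordinate of a chart. -/
theorem exists_adapted_chart {u : M → ℝ} (hu : ContMDiff (𝓡 (d + 1)) 𝓘(ℝ, ℝ) ∞ u) {x : M}
    (hx : differential (d := d) u x ≠ 0) :
    ∃ e : OpenPartialHomeomorph M (Model d), IsChart e ∧ x ∈ e.source ∧
      ∀ z ∈ e.source, e z 0 = u z := by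
  have he := isChart_chartAt (d := d) x
  set e := chartAt (Model d) x with he_def
  have hxe : x ∈ e.source := mem_chart_source _ x
  rw [differential_eq hu.contMDiffAt] at hx
  obtain ⟨φ, hxφ, -, hφ, hφs, h0⟩ := exists_straightening e.open_target (contDiffOn_comp_symm he hu)
    (e.map_source hxe) hx
  refine ⟨e ≫ₕ φ, he.trans hφ hφs, ?_, fun z hz => ?_⟩
  · rw [OpenPartialHomeomorph.trans_source]
    exact ⟨hxe, hxφ⟩
  · rw [OpenPartialHomeomorph.trans_source] at hz
    rw [OpenPartialHomeomorph.trans_apply, h0, Function.comp_apply, e.left_inv hz.1]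

/-- The point `(t, y)` of the hyperplane `{x⁰ = t}`. -/
def levelPoint (t : ℝ) (y : EuclideanSpace ℝ (Fin d)) : Model d :=
  WithLp.toLp 2 (Fin.cons t (fun i => y i) : Fin (d + 1) → ℝ)

/-- The last `d` coordinates of a point of the model space. -/
def tailL (d : ℕ) : Model d →L[ℝ] EuclideanSpace ℝ (Fin d) :=
  LinearMap.toContinuousLinearMap
    { toFun := fun z => WithLp.toLp 2 fun i => z i.succ
      map_add' := fun a b => by ext j; simp
      map_smul' := fun c b => by ext j; simp }

@[simp] theorem tailL_apply (z : Model d) (i : Fin d) : tailL d z i = z i.succ := rfl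

@[simp] theorem levelPoint_zero_coord (t : ℝ) (y : EuclideanSpace ℝ (Fin d)) :
    levelPoint t y 0 = t := rfl

@[simp] theorem tailL_levelPoint (t : ℝ) (y : EuclideanSpace ℝ (Fin d)) :
    tailL d (levelPoint t y) = y := rfl

theorem levelPoint_tailL {t : ℝ} {z : Model d} (hz : z 0 = t) : levelPoint t (tailL d z) = z := by
  ext j
  refine Fin.cases ?_ (fun j => ?_) j
  · exact hz.symm
  · rfl

theorem levelPoint_eq (t : ℝ) (y : EuclideanSpace ℝ (Fin d)) :
    levelPoint t y = sliceL d y + EuclideanSpace.single 0 t := by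
  ext j
  refine Fin.cases ?_ (fun j => ?_) j
  · simp [levelPoint, sliceL, slicePoint]
  · simp [levelPoint, sliceL, slicePoint]

theorem hasFDerivAt_levelPoint (t : ℝ) (y : EuclideanSpace ℝ (Fin d)) :
    HasFDerivAt (levelPoint t) (sliceL d) y := by
  have : (levelPoint t : EuclideanSpace ℝ (Fin d) → Model d) =
      fun y => sliceL d y + EuclideanSpace.single 0 t := funext (levelPoint_eq t)
  rw [this]
  exact (sliceL d).hasFDerivAt.add_const _

theorem continuous_levelPoint : Continuous fun q : ℝ × EuclideanSpace ℝ (Fin d) =>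
    (levelPoint q.1 q.2 : Model d) := by
  refine (PiLp.continuous_toLp 2 _).comp (continuous_pi fun j => ?_)
  refine Fin.cases ?_ (fun j => ?_) j
  · exact continuous_fst
  · exact (EuclideanSpace.proj (𝕜 := ℝ) j).continuous.comp continuous_snd

/-- Expand along the zeroth row: only its first entry is nonzero, since `T` preserves the hyperplane
`{x⁰ = 0}`. -/
theorem det_eq_mul_det_tail (T : Model d →L[ℝ] Model d) (hT : ∀ w, T (sliceL d w) 0 = 0) :
    T.det = T (EuclideanSpace.single 0 1) 0 * ((tailL d).comp (T.comp (sliceL d))).det := by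
  have hsl : ∀ j : Fin d, sliceL d (EuclideanSpace.single j 1) =
      EuclideanSpace.single j.succ 1 := fun j => by
    ext i
    refine Fin.cases ?_ (fun i => ?_) i
    · simp [sliceL, slicePoint]
    · simp [sliceL, slicePoint]
  let b := (EuclideanSpace.basisFun (Fin (d + 1)) ℝ).toBasis
  let b' := (EuclideanSpace.basisFun (Fin d) ℝ).toBasis
  change LinearMap.det (T : Model d →ₗ[ℝ] Model d) = _ * LinearMap.det
    (((tailL d).comp (T.comp (sliceL d))) : EuclideanSpace ℝ (Fin d) →ₗ[ℝ] EuclideanSpace ℝ (Fin d))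
  rw [← LinearMap.det_toMatrix b, ← LinearMap.det_toMatrix b', Matrix.det_succ_row_zero,
    Fin.sum_univ_succ]
  have hb : ∀ i j, LinearMap.toMatrix b b (T : Model d →ₗ[ℝ] Model d) i j =
      T (EuclideanSpace.single j 1) i := fun i j => by
    simp [LinearMap.toMatrix_apply, b]
  have hb' : ∀ i j, LinearMap.toMatrix b' b'
      (((tailL d).comp (T.comp (sliceL d))) : EuclideanSpace ℝ (Fin d) →ₗ[ℝ] EuclideanSpace ℝ (Fin d)) i j =
      T (EuclideanSpace.single j.succ 1) i.succ := fun i j => by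
    simp [LinearMap.toMatrix_apply, b', hsl]
  rw [Finset.sum_eq_zero]
  · simp only [hb, Fin.val_zero, pow_zero, one_mul, add_zero]
    congr 2
    ext i j
    rw [hb', Matrix.submatrix_apply, hb]
    simp
  · intro j _
    have h0 := hT (EuclideanSpace.single j 1)
    rw [hsl] at h0
    rw [hb, h0]
    simp

end Adapted

/-! ### Transformation law of the density -/

section Density

variable {d : ℕ} {M : Type*} [TopologicalSpace M] [ChartedSpace (Model d) M]
  [IsManifold (𝓡 (d + 1)) ∞ M] [MeasurableSpace M] [BorelSpace M] (m : SmoothMeasure d M)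

theorem SmoothMeasure.continuousOn_exp {e : OpenPartialHomeomorph M (Model d)} (he : IsChart e) :
    ContinuousOn (fun z => ENNReal.ofReal (Real.exp (m.logDensity e z))) e.target :=
  ENNReal.continuous_ofReal.comp_continuousOn
    (Real.continuous_exp.comp_continuousOn (m.smooth e he).continuousOn)

/-- By the change of variables formula both sides are densities of the same measure in the chart
`e`, hence equal almost everywhere, and by continuity everywhere. The pointwise identity is
essential, because hypersurfaces are null sets. -/
theorem SmoothMeasure.exp_logDensity_change {e e' : OpenPartialHomeomorph M (Model d)}
    (he : IsChart e) (he' : IsChart e') {x : M} (hx : x ∈ e.source) (hx' : x ∈ e'.source) :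
    Real.exp (m.logDensity e (e x)) = |(fderiv ℝ (e' ∘ e.symm) (e x)).det| *
      Real.exp (m.logDensity e' (e' x)) := by
  let V : Set (Model d) := e.target ∩ e.symm ⁻¹' e'.source
  have hV : IsOpen V := e.isOpen_inter_preimage_symm e'.open_source
  have hsm : ContDiffOn ℝ ∞ (e' ∘ e.symm) V := fun z hz => by
    have := contDiffAt_comp_symm he (e.map_target hz.1) (contMDiffAt_chart he' hz.2)
    rw [e.right_inv hz.1] at this
    exact this.contDiffWithinAt
  have hmaps : MapsTo (e' ∘ e.symm) V e'.target := fun z hz => e'.map_source hz.2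
  have hinj : InjOn (e' ∘ e.symm) V := fun z hz z' hz' h =>
    e.symm.injOn hz.1 hz'.1 (e'.injOn hz.2 hz'.2 h)
  have hc1 : ContinuousOn (fun z => ENNReal.ofReal (Real.exp (m.logDensity e z))) V :=
    (m.continuousOn_exp he).mono inter_subset_left
  have hdet : ContinuousOn (fun z => ENNReal.ofReal |(fderiv ℝ (e' ∘ e.symm) z).det|) V := by
    refine ENNReal.continuous_ofReal.comp_continuousOn (continuous_abs.comp_continuousOn ?_)
    exact ContinuousLinearMap.continuous_det.comp_continuousOn
      (contDiffOn_fderiv hV hsm).continuousOn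
  have hc2 : ContinuousOn (fun z => ENNReal.ofReal |(fderiv ℝ (e' ∘ e.symm) z).det| *
      ENNReal.ofReal (Real.exp (m.logDensity e' ((e' ∘ e.symm) z)))) V := by
    intro z hz
    refine ENNReal.Tendsto.mul (hdet z hz) (Or.inr ENNReal.ofReal_ne_top)
      (((m.continuousOn_exp he').comp hsm.continuousOn hmaps) z hz) (Or.inr ENNReal.ofReal_ne_top)
  have hae : (fun z => ENNReal.ofReal (Real.exp (m.logDensity e z))) =ᵐ[volume.restrict V]
      fun z => ENNReal.ofReal |(fderiv ℝ (e' ∘ e.symm) z).det| *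
        ENNReal.ofReal (Real.exp (m.logDensity e' ((e' ∘ e.symm) z))) := by
    refine ae_eq_of_forall_setLIntegral_eq_of_sigmaFinite₀ (hc1.aemeasurable hV.measurableSet)
      (hc2.aemeasurable hV.measurableSet) fun B hB _ => ?_
    rw [Measure.restrict_restrict hB]
    have hBV : MeasurableSet (B ∩ V) := hB.inter hV.measurableSet
    have hsub : B ∩ V ⊆ V := inter_subset_right
    rw [← m.chart_eq e he (B ∩ V) hBV (fun z hz => hz.2.1),
      ← lintegral_image_eq_lintegral_abs_det_fderiv_mul volume hBV
        (fun z hz => ((hsm.contDiffAt (hV.mem_nhds hz.2)).differentiableAt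
          (by simp)).hasFDerivAt.hasFDerivWithinAt) (hinj.mono hsub)
        (fun z => ENNReal.ofReal (Real.exp (m.logDensity e' z))),
      ← m.chart_eq e' he' _ (hBV.image_of_continuousOn_injOn (hsm.continuousOn.mono hsub)
        (hinj.mono hsub)) ((hmaps.mono_left hsub).image_subset)]
    congr 1
    rw [← image_comp]
    exact image_congr fun z hz => (e'.left_inv hz.2.2).symm
  have hxV : e x ∈ V := ⟨e.map_source hx, by simpa [e.left_inv hx] using hx'⟩
  have := Measure.eqOn_open_of_ae_eq hae hV hc1 hc2 hxV
  simp only [Function.comp_apply, e.left_inv hx] at this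
  rw [← ENNReal.ofReal_mul (abs_nonneg _)] at this
  exact (ENNReal.ofReal_eq_ofReal_iff (Real.exp_pos _).le (by positivity)).1 this

end Density

/-! ### Comparison of area elements in different charts -/

section SliceArea

variable {d : ℕ} {M : Type*} [TopologicalSpace M] [ChartedSpace (Model d) M]
  [IsManifold (𝓡 (d + 1)) ∞ M] [MeasurableSpace M] [BorelSpace M] (m : SmoothMeasure d M)

theorem measurableSet_target_inter_preimage (e : OpenPartialHomeomorph M (Model d)) {A : Set M}
    (hA : MeasurableSet A) : MeasurableSet (e.target ∩ e.symm ⁻¹' A) := by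
  have h := (continuousOn_iff_continuous_domRestrict.1 e.symm.continuousOn).measurable hA
  have : MeasurableSet (Subtype.val '' (Subtype.val ⁻¹' (e.symm ⁻¹' A) : Set e.target)) :=
    MeasurableSet.subtype_image e.open_target.measurableSet h
  rwa [Subtype.image_preimage_coe] at this

/-- The points `y` such that `(t, y)` represents a point of `A` in the chart `e`. -/
def levelSet (e : OpenPartialHomeomorph M (Model d)) (t : ℝ) (A : Set M) :
    Set (EuclideanSpace ℝ (Fin d)) :=
  {y | levelPoint t y ∈ e.target ∧ e.symm (levelPoint t y) ∈ A}

theorem measurableSet_levelSet (e : OpenPartialHomeomorph M (Model d)) (t : ℝ) {A : Set M}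
    (hA : MeasurableSet A) : MeasurableSet (levelSet e t A) :=
  (continuous_levelPoint.comp (Continuous.prodMk_right t)).measurable
    (measurableSet_target_inter_preimage e hA)

/-- Passing from a slice chart `e'` of the level set `{u = t}` to a chart `e` with zeroth coordinate
`u` does not change the area element. -/
theorem areaElement_change {u : M → ℝ} {e e' : OpenPartialHomeomorph M (Model d)} {t : ℝ}
    (he : IsChart e) (heu : ∀ z ∈ e.source, e z 0 = u z) (he' : IsSliceChart {x | u x = t} e')
    (n : (x : M) → TangentSpace (𝓡 (d + 1)) x) {y : EuclideanSpace ℝ (Fin d)}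
    (hy : levelPoint t y ∈ e.target) (hy' : e.symm (levelPoint t y) ∈ e'.source) :
    ∃ D : EuclideanSpace ℝ (Fin d) →L[ℝ] EuclideanSpace ℝ (Fin d),
      HasFDerivAt (fun y => tailL d (e' (e.symm (levelPoint t y)))) D y ∧
      |D.det| * (Real.exp (m.logDensity e' (e' (e.symm (levelPoint t y)))) *
          |differential (fun z => e' z 0) (e.symm (levelPoint t y))
            (n (e.symm (levelPoint t y)))|) =
        Real.exp (m.logDensity e (levelPoint t y)) *
          |differential u (e.symm (levelPoint t y)) (n (e.symm (levelPoint t y)))| := by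
  obtain ⟨x, hx, hxe, hex⟩ : ∃ x, e.symm (levelPoint t y) = x ∧ x ∈ e.source ∧
    e x = levelPoint t y := ⟨_, rfl, e.map_target hy, e.right_inv hy⟩
  rw [hx] at hy' ⊢
  set T : Model d →L[ℝ] Model d := fderiv ℝ (e' ∘ e.symm) (e x) with hTdef
  have hT : HasFDerivAt (e' ∘ e.symm) T (levelPoint t y) := by
    rw [← hex]
    exact (differentiableAt_comp_symm he hxe (contMDiffAt_chart he'.1 hy')).hasFDerivAt
  have hTl : HasFDerivAt (fun y => e' (e.symm (levelPoint t y))) (T.comp (sliceL d)) y :=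
    hT.comp y (hasFDerivAt_levelPoint t y)
  have hcont : Continuous fun y : EuclideanSpace ℝ (Fin d) => (levelPoint t y : Model d) :=
    continuous_levelPoint.comp (Continuous.prodMk_right t)
  -- The transition map sends the hyperplane `{x⁰ = t}` into `{x⁰ = 0}`, since both describe the
  -- same level set.
  have hT0 : ∀ w, T (sliceL d w) 0 = 0 := by
    have h1 : HasFDerivAt (fun y => e' (e.symm (levelPoint t y)) 0)
        ((EuclideanSpace.proj (𝕜 := ℝ) (0 : Fin (d + 1))).comp (T.comp (sliceL d))) y :=
      (EuclideanSpace.proj (𝕜 := ℝ) (0 : Fin (d + 1))).hasFDerivAt.comp y hTl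
    have hV : levelPoint t ⁻¹' (e.target ∩ e.symm ⁻¹' e'.source) ∈ 𝓝 y :=
      ((e.isOpen_inter_preimage_symm e'.open_source).preimage hcont).mem_nhds
        ⟨hy, by rw [mem_preimage, hx]; exact hy'⟩
    have h2 : HasFDerivAt (fun y => e' (e.symm (levelPoint t y)) 0)
        (0 : EuclideanSpace ℝ (Fin d) →L[ℝ] ℝ) y := by
      refine (hasFDerivAt_const (0 : ℝ) y).congr_of_eventuallyEq ?_
      filter_upwards [hV] with y' hy'
      refine (he'.2 _ hy'.2).1 ?_
      change u _ = t
      rw [← heu _ (e.map_target hy'.1), e.right_inv hy'.1, levelPoint_zero_coord]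
    intro w
    exact congrArg (fun L : EuclideanSpace ℝ (Fin d) →L[ℝ] ℝ => L w) (h1.unique h2)
  refine ⟨(tailL d).comp (T.comp (sliceL d)), (tailL d).hasFDerivAt.comp y hTl, ?_⟩
  set ξ : Model d := fderiv ℝ (e ∘ (chartAt (Model d) x).symm) (chartAt (Model d) x x) (n x)
  have hu : differential u x (n x) = ξ 0 := by
    have hud : ContMDiffAt (𝓡 (d + 1)) 𝓘(ℝ, ℝ) ∞ u x :=
      (contMDiffAt_chart_zero he hxe).congr_of_eventuallyEq (by
        filter_upwards [e.open_source.mem_nhds hxe] with z hz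
        exact (heu z hz).symm)
    have hpr : fderiv ℝ (u ∘ e.symm) (e x) = EuclideanSpace.proj (𝕜 := ℝ) (0 : Fin (d + 1)) := by
      refine ((EuclideanSpace.proj (𝕜 := ℝ) (0 : Fin (d + 1))).hasFDerivAt.congr_of_eventuallyEq ?_).fderiv
      filter_upwards [e.open_target.mem_nhds (e.map_source hxe)] with z hz
      rw [Function.comp_apply, ← heu _ (e.map_target hz), e.right_inv hz]
      rfl
    rw [differential_eq_comp he hxe hud, hpr]
    rfl
  have he'n : differential (fun z => e' z 0) x (n x) = ξ 0 * T (EuclideanSpace.single 0 1) 0 := by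
    rw [differential_eq_comp he hxe (contMDiffAt_chart_zero he'.1 hy')]
    have : fderiv ℝ ((fun z => e' z 0) ∘ e.symm) (e x) =
        (EuclideanSpace.proj (𝕜 := ℝ) (0 : Fin (d + 1))).comp T := by
      rw [hex]
      exact ((EuclideanSpace.proj (𝕜 := ℝ) (0 : Fin (d + 1))).hasFDerivAt.comp _ hT).fderiv
    rw [this]
    change T ξ 0 = _
    have hξ : ξ = sliceL d (tailL d ξ) + ξ 0 • EuclideanSpace.single 0 1 := by
      have hs : (EuclideanSpace.single 0 (ξ 0) : Model d) = ξ 0 • EuclideanSpace.single 0 1 := by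
        ext j
        refine Fin.cases ?_ (fun j => ?_) j <;> simp
      rw [← hs, ← levelPoint_eq, levelPoint_tailL rfl]
    have : T ξ = T (sliceL d (tailL d ξ)) + ξ 0 • T (EuclideanSpace.single 0 1) := by
      conv_lhs => rw [hξ, map_add, map_smul]
    rw [this, PiLp.add_apply, hT0, zero_add, PiLp.smul_apply, smul_eq_mul]
  -- The normal factor `T(e₀)⁰` of the Jacobian determinant is also the factor relating the zeroth
  -- components of `n`. It cancels, leaving the tangential determinant.
  have hdens := m.exp_logDensity_change he he'.1 hxe hy'
  rw [← hTdef, det_eq_mul_det_tail T hT0, abs_mul] at hdens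
  rw [hu, he'n, ← hex, hdens, abs_mul]
  ring

/-- The area element of a slice chart of `{u = t}`, in the coordinates of a chart with zeroth
coordinate `u`. -/
theorem sliceArea_le {u : M → ℝ} {e e' : OpenPartialHomeomorph M (Model d)} {t : ℝ}
    (he : IsChart e) (heu : ∀ z ∈ e.source, e z 0 = u z) (he' : IsSliceChart {x | u x = t} e')
    (n : (x : M) → TangentSpace (𝓡 (d + 1)) x) {A : Set M} (hA : MeasurableSet A)
    (hAe : A ⊆ e.source) :
    sliceArea m n e' A ≤ ∫⁻ y in levelSet e t A,
      ENNReal.ofReal (Real.exp (m.logDensity e (levelPoint t y)) *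
        |differential u (e.symm (levelPoint t y)) (n (e.symm (levelPoint t y)))|) := by
  rw [sliceArea]
  -- A pushforward along a map that is not a.e.-measurable is zero by convention, and the bound is
  -- then trivial.
  by_cases hae : AEMeasurable (fun y : EuclideanSpace ℝ (Fin d) => e'.symm (slicePoint y))
    ((volume.restrict {y : EuclideanSpace ℝ (Fin d) | slicePoint y ∈ e'.target}).withDensity
    (fun y => ENNReal.ofReal (Real.exp (m.logDensity e' (slicePoint y)) *
      |differential (fun z => e' z 0) (e'.symm (slicePoint y)) (n (e'.symm (slicePoint y)))|)))
  swap
  · rw [Measure.map_of_not_aemeasurable hae]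
    simp
  have hT' : MeasurableSet {y : EuclideanSpace ℝ (Fin d) | slicePoint y ∈ e'.target} :=
    (e'.open_target.preimage (sliceL d).continuous).measurableSet
  rw [Measure.map_apply_of_aemeasurable hae hA, withDensity_apply',
    Measure.restrict_restrict' hT']
  set Q := levelSet e t (A ∩ e'.source)
  have hQ : MeasurableSet Q := measurableSet_levelSet e t (hA.inter e'.open_source.measurableSet)
  -- The transition between the hyperplane coordinates of `e` and those of `e'`. The change of
  -- variables formula for lower integrals requires no measurability of the integrand, so none is
  -- needed for `n`.
  let θ : EuclideanSpace ℝ (Fin d) → EuclideanSpace ℝ (Fin d) :=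
    fun y => tailL d (e' (e.symm (levelPoint t y)))
  have hθ : ∀ y ∈ Q, slicePoint (θ y) = e' (e.symm (levelPoint t y)) := by
    intro y hy
    refine levelPoint_tailL ((he'.2 _ hy.2.2).1 ?_)
    change u _ = t
    rw [← heu _ (e.map_target hy.1), e.right_inv hy.1, levelPoint_zero_coord]
  have himg : (fun y : EuclideanSpace ℝ (Fin d) => e'.symm (slicePoint y)) ⁻¹' A ∩
      {y : EuclideanSpace ℝ (Fin d) | slicePoint y ∈ e'.target} ⊆ θ '' Q := by
    rintro y ⟨hyA, hyt⟩
    have hxe' := e'.map_target hyt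
    have hux : u (e'.symm (slicePoint y)) = t := by
      refine (he'.2 _ hxe').2 ?_
      rw [e'.right_inv hyt]
      rfl
    have hxe := hAe hyA
    have hlev : levelPoint t (tailL d (e (e'.symm (slicePoint y)))) = e (e'.symm (slicePoint y)) :=
      levelPoint_tailL ((heu _ hxe).trans hux)
    refine ⟨tailL d (e (e'.symm (slicePoint y))), ⟨?_, ?_⟩, ?_⟩
    · rw [hlev]
      exact e.map_source hxe
    · rw [hlev, e.left_inv hxe]
      exact ⟨hyA, hxe'⟩
    · simp only [θ]
      rw [hlev, e.left_inv hxe, e'.right_inv hyt]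
      rfl
  have hinj : InjOn θ Q := by
    intro y₁ h₁ y₂ h₂ h
    have h' : e' (e.symm (levelPoint t y₁)) = e' (e.symm (levelPoint t y₂)) := by
      rw [← hθ y₁ h₁, ← hθ y₂ h₂, h]
    have := e.symm.injOn h₁.1 h₂.1 (e'.injOn h₁.2.2 h₂.2.2 h')
    rw [← tailL_levelPoint t y₁, this, tailL_levelPoint]
  have hD := fun y (hy : y ∈ Q) => areaElement_change m he heu he' n hy.1 hy.2.2
  choose! D hD hDet using hD
  refine (lintegral_mono_set himg).trans ?_
  rw [lintegral_image_eq_lintegral_abs_det_fderiv_mul volume hQ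
    (fun y hy => (hD y hy).hasFDerivWithinAt) hinj]
  refine le_trans (le_of_eq (setLIntegral_congr_fun hQ fun y hy => ?_))
    (lintegral_mono_set (t := levelSet e t A) fun y hy => ⟨hy.1, hy.2.1⟩)
  simp only
  rw [← ENNReal.ofReal_mul (abs_nonneg _), hθ y hy, e'.left_inv hy.2.2, hDet y hy]

theorem sliceArea_eq_zero {Γ A : Set M} {e : OpenPartialHomeomorph M (Model d)}
    (he : IsSliceChart Γ e) (n : (x : M) → TangentSpace (𝓡 (d + 1)) x)
    (hA : MeasurableSet A) (hAΓ : Disjoint A Γ) : sliceArea m n e A = 0 := by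
  rw [sliceArea]
  by_cases hae : AEMeasurable (fun y : EuclideanSpace ℝ (Fin d) => e.symm (slicePoint y))
    ((volume.restrict {y : EuclideanSpace ℝ (Fin d) | slicePoint y ∈ e.target}).withDensity
    (fun y => ENNReal.ofReal (Real.exp (m.logDensity e (slicePoint y)) *
      |differential (fun z => e z 0) (e.symm (slicePoint y)) (n (e.symm (slicePoint y)))|)))
  swap
  · rw [Measure.map_of_not_aemeasurable hae]
    simp
  have hT' : MeasurableSet {y : EuclideanSpace ℝ (Fin d) | slicePoint y ∈ e.target} :=
    (e.open_target.preimage (sliceL d).continuous).measurableSet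
  rw [Measure.map_apply_of_aemeasurable hae hA, withDensity_apply',
    Measure.restrict_restrict' hT']
  have : (fun y : EuclideanSpace ℝ (Fin d) => e.symm (slicePoint y)) ⁻¹' A ∩
      {y : EuclideanSpace ℝ (Fin d) | slicePoint y ∈ e.target} = ∅ := by
    refine eq_empty_of_forall_notMem fun y hy => ?_
    refine disjoint_left.1 hAΓ hy.1 ((he.2 _ (e.map_target hy.2)).2 ?_)
    rw [e.right_inv hy.2]
    rfl
  rw [this]
  simp

end SliceArea

/-! ### Unit normals of level sets -/

section Normal

variable {d : ℕ} {M : Type*} [TopologicalSpace M] [ChartedSpace (Model d) M]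
  [IsManifold (𝓡 (d + 1)) ∞ M] (F : Metric d M)

/-- A smooth function minus a constant is the zeroth coordinate of a slice chart near a regular
point. -/
theorem exists_sliceChart {u : M → ℝ} (hu : ContMDiff (𝓡 (d + 1)) 𝓘(ℝ, ℝ) ∞ u) {x : M}
    (hx : differential (d := d) u x ≠ 0) :
    ∃ e : OpenPartialHomeomorph M (Model d), IsSliceChart {z | u z = u x} e ∧ x ∈ e.source ∧
      ∀ z ∈ e.source, e z 0 = u z - u x := by
  obtain ⟨e, he, hxe, heu⟩ := exists_adapted_chart hu hx
  let φ := (Homeomorph.addRight (-EuclideanSpace.single 0 (u x) : Model d)).toOpenPartialHomeomorph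
  have hφ : ∀ z ∈ (e ≫ₕ φ).source, (e ≫ₕ φ) z 0 = u z - u x := fun z hz => by
    simp only [φ, OpenPartialHomeomorph.trans_source] at hz
    simp [φ, heu z hz.1, sub_eq_add_neg]
  refine ⟨e ≫ₕ φ, ⟨he.trans ?_ ?_, fun z hz => ?_⟩, ?_, hφ⟩
  · exact (contDiff_id.add contDiff_const).contDiffOn
  · exact (contDiff_id.add contDiff_const).contDiffOn
  · rw [hφ z hz, sub_eq_zero]
    rfl
  · simpa [φ] using hxe

theorem hasDerivAt_comp_chart_line {u : M → ℝ} (hu : ContMDiff (𝓡 (d + 1)) 𝓘(ℝ, ℝ) ∞ u) (x : M)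
    (v : Model d) : HasDerivAt (fun s : ℝ => u ((chartAt (Model d) x).symm
      (chartAt (Model d) x x + s • v))) (differential u x v) 0 := by
  have h1 := (differentiableAt_comp_symm (isChart_chartAt x) (mem_chart_source (Model d) x)
    hu.contMDiffAt).hasFDerivAt
  rw [← differential_eq hu.contMDiffAt] at h1
  have h2 : HasDerivAt (fun s : ℝ => chartAt (Model d) x x + s • v) v 0 := by
    simpa using ((hasDerivAt_id (0 : ℝ)).smul_const v).const_add (chartAt (Model d) x x)
  have h3 : HasFDerivAt (u ∘ (chartAt (Model d) x).symm) (differential u x : Model d →L[ℝ] ℝ)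
      (chartAt (Model d) x x + (0 : ℝ) • v) := by
    rw [zero_smul, add_zero]
    exact h1
  exact h3.comp_hasDerivAt (0 : ℝ) h2

theorem eventually_lt_of_differential_pos {u : M → ℝ}
    (hu : ContMDiff (𝓡 (d + 1)) 𝓘(ℝ, ℝ) ∞ u) {x : M} {n : Model d}
    (hn : 0 < differential u x n) : ∀ᶠ s in 𝓝[>] (0 : ℝ),
      u x < u ((chartAt (Model d) x).symm (chartAt (Model d) x x + s • n)) := by
  have hd := (hasDerivAt_comp_chart_line hu x n).tendsto_slope_zero_right
  filter_upwards [hd.eventually (lt_mem_nhds hn), self_mem_nhdsWithin] with s hs hs0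
  have hs0' : 0 < s := hs0
  simp only [zero_add, zero_smul, add_zero, smul_eq_mul,
    (chartAt (Model d) x).left_inv (mem_chart_source _ x)] at hs
  exact sub_pos.1 ((pos_iff_pos_of_mul_pos hs).1 (inv_pos.2 hs0'))

theorem eventually_lt_of_differential_neg {u : M → ℝ}
    (hu : ContMDiff (𝓡 (d + 1)) 𝓘(ℝ, ℝ) ∞ u) {x : M} {n : Model d}
    (hn : differential u x n < 0) : ∀ᶠ s in 𝓝[>] (0 : ℝ),
      u ((chartAt (Model d) x).symm (chartAt (Model d) x x + s • n)) < u x := by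
  have hd := (hasDerivAt_comp_chart_line hu x n).tendsto_slope_zero_right
  filter_upwards [hd.eventually (gt_mem_nhds hn), self_mem_nhdsWithin] with s hs hs0
  have hs0' : 0 < s := hs0
  simp only [zero_add, zero_smul, add_zero, smul_eq_mul,
    (chartAt (Model d) x).left_inv (mem_chart_source _ x)] at hs
  by_contra! hle
  exact hs.not_ge (mul_nonneg (inv_nonneg.2 hs0'.le) (sub_nonneg.2 hle))

theorem tendsto_chart_line (x : M) (n : Model d) :
    Tendsto (fun s : ℝ => (chartAt (Model d) x).symm (chartAt (Model d) x x + s • n))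
      (𝓝[>] 0) (𝓝 x) := by
  have h1 : Tendsto (fun s : ℝ => chartAt (Model d) x x + s • n) (𝓝[>] 0)
      (𝓝 (chartAt (Model d) x x)) := by
    have : Continuous fun s : ℝ => chartAt (Model d) x x + s • n := by fun_prop
    simpa using (this.tendsto 0).mono_left nhdsWithin_le_nhds
  have h2 := ((chartAt (Model d) x).continuousAt_symm (mem_chart_target _ x)).tendsto.comp h1
  rwa [(chartAt (Model d) x).left_inv (mem_chart_source _ x)] at h2

theorem differential_nonneg_of_pointsInto {u : M → ℝ}
    (hu : ContMDiff (𝓡 (d + 1)) 𝓘(ℝ, ℝ) ∞ u) {x : M} {n : Model d}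
    (hn : PointsInto {z | u x < u z} x n) : 0 ≤ differential u x n := by
  refine ge_of_tendsto (hasDerivAt_comp_chart_line hu x n).tendsto_slope_zero_right ?_
  filter_upwards [hn, self_mem_nhdsWithin] with s hs hs0
  have hs0' : 0 < s := hs0
  simp only [zero_add, zero_smul, add_zero, smul_eq_mul,
    (chartAt (Model d) x).left_inv (mem_chart_source _ x)]
  exact mul_nonneg (inv_nonneg.2 hs0'.le) (sub_nonneg.2 (le_of_lt hs))

/-- The normalized Legendre transform of `du` is a unit normal pointing into the superlevel set, so
the choice defining `unitNormal` satisfies its specification. Pointing inwards yields only a weak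
inequality, as a limit of difference quotients, and that suffices. -/
theorem Metric.unitNormal_spec {u : M → ℝ} (hu : ContMDiff (𝓡 (d + 1)) 𝓘(ℝ, ℝ) ∞ u) {x : M}
    (hx : differential (d := d) u x ≠ 0) :
    F.toFun x (F.unitNormal {z | u z = u x} {z | u x < u z} x) = 1 ∧
      0 ≤ differential u x (F.unitNormal {z | u z = u x} {z | u x < u z} x) := by
  have hex : ∃ n : TangentSpace (𝓡 (d + 1)) x, F.toFun x n = 1 ∧
      (∀ w, IsTangent {z | u z = u x} x w → F.fundamental x n n w = 0) ∧
      PointsInto {z | u x < u z} x n := by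
    obtain ⟨n, hn1, hnpos, hn⟩ := (F.isMinkowski x).exists_normal (α := differential u x) hx
    refine ⟨n, hn1, fun w hw => hn w ?_, ?_⟩
    -- Tangency is tested in all slice charts; the one with zeroth coordinate `u - u x` shows that a
    -- tangent vector is annihilated by `du`.
    · obtain ⟨e, he, hxe, heu⟩ := exists_sliceChart hu hx
      have h0 := hw e he hxe
      have hd : differential (fun z => e z 0) x = differential (d := d) u x := by
        rw [differential_eq (contMDiffAt_chart_zero he.1 hxe), differential_eq hu.contMDiffAt]
        refine (Filter.EventuallyEq.fderiv_eq ?_).trans (fderiv_sub_const (u x))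
        have hs : (chartAt (Model d) x).target ∩ (chartAt (Model d) x).symm ⁻¹' e.source ∈
            𝓝 (chartAt (Model d) x x) :=
          ((chartAt (Model d) x).isOpen_inter_preimage_symm e.open_source).mem_nhds
            ⟨mem_chart_target _ x, by simpa using hxe⟩
        filter_upwards [hs] with z hz
        exact heu _ hz.2
      rw [hd] at h0
      exact h0
    · exact eventually_lt_of_differential_pos hu hnpos
  obtain ⟨h1, -, h3⟩ := Classical.epsilon_spec hex
  exact ⟨h1, differential_nonneg_of_pointsInto hu h3⟩

/-- This inequality is where the area of a level set is controlled by the dual norm. An upper bound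
for the area is all that is needed. -/
theorem Metric.abs_differential_unitNormal_le {u : M → ℝ}
    (hu : ContMDiff (𝓡 (d + 1)) 𝓘(ℝ, ℝ) ∞ u) {x : M} {t : ℝ} (ht : u x = t)
    (hx : differential (d := d) u x ≠ 0) :
    |differential u x (F.unitNormal {z | u z = t} {z | t < u z} x)| ≤
      F.dual x (differential u x) := by
  subst ht
  obtain ⟨h1, h0⟩ := F.unitNormal_spec hu hx
  rw [abs_of_nonneg h0]
  have := F.apply_le_dual_mul x (differential u x) (F.unitNormal {z | u z = u x} {z | u x < u z} x)
  rwa [h1, mul_one] at this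

end Normal

/-! ### The coarea inequality -/

section Coarea

variable {d : ℕ} {M : Type*} [TopologicalSpace M] [ChartedSpace (Model d) M]
  [IsManifold (𝓡 (d + 1)) ∞ M] [MeasurableSpace M] [BorelSpace M]

theorem measurePreserving_levelPoint (d : ℕ) : MeasurePreserving
    (fun q : ℝ × EuclideanSpace ℝ (Fin d) => (levelPoint q.1 q.2 : Model d)) := by
  have h1 : MeasurePreserving (Prod.map id (WithLp.ofLp (p := 2)) :
      ℝ × EuclideanSpace ℝ (Fin d) → ℝ × (Fin d → ℝ)) :=
    (MeasurePreserving.id volume).prod (PiLp.volume_preserving_ofLp (Fin d))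
  have h2 := (volume_preserving_piFinSuccAbove (fun _ : Fin (d + 1) => ℝ) 0).symm
  have h3 := (PiLp.volume_preserving_toLp (Fin (d + 1))).comp (h2.comp h1)
  convert! h3 using 1
  ext q j
  simp [levelPoint, MeasurableEquiv.piFinSuccAbove]

theorem aemeasurable_symm (e : OpenPartialHomeomorph M (Model d)) {T : Set (Model d)}
    (hT : MeasurableSet T) (hTe : T ⊆ e.target) : AEMeasurable e.symm (volume.restrict T) :=
  (e.symm.continuousOn.mono hTe).aemeasurable hT

variable (m : SmoothMeasure d M)

theorem SmoothMeasure.restrict_eq_map {e : OpenPartialHomeomorph M (Model d)} (he : IsChart e)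
    {B : Set M} (hB : MeasurableSet B) (hBe : B ⊆ e.source) :
    m.measure.restrict B = ((volume.restrict (e.target ∩ e.symm ⁻¹' B)).withDensity
      fun z => ENNReal.ofReal (Real.exp (m.logDensity e z))).map e.symm := by
  have hT := measurableSet_target_inter_preimage e hB
  have hs := (aemeasurable_symm e hT inter_subset_left).mono_ac
    (withDensity_absolutelyContinuous (volume.restrict (e.target ∩ e.symm ⁻¹' B))
      fun z => ENNReal.ofReal (Real.exp (m.logDensity e z)))
  ext A hA
  rw [Measure.map_apply_of_aemeasurable hs hA, withDensity_apply', Measure.restrict_restrict' hT,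
    Measure.restrict_apply hA]
  have hset : e.symm ⁻¹' A ∩ (e.target ∩ e.symm ⁻¹' B) = e.target ∩ e.symm ⁻¹' (A ∩ B) := by
    rw [preimage_inter]
    tauto_set
  rw [hset, ← m.chart_eq e he _ (measurableSet_target_inter_preimage e (hA.inter hB))
    inter_subset_left]
  congr 1
  ext x
  constructor
  · intro hx
    have hxe := hBe hx.2
    exact ⟨e x, ⟨e.map_source hxe, by rwa [mem_preimage, e.left_inv hxe]⟩, e.left_inv hxe⟩
  · rintro ⟨z, ⟨-, hz⟩, rfl⟩
    exact hz

theorem SmoothMeasure.aemeasurable_density {e : OpenPartialHomeomorph M (Model d)}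
    (he : IsChart e) {B : Set M} (hB : MeasurableSet B) :
    AEMeasurable (fun z => ENNReal.ofReal (Real.exp (m.logDensity e z)))
      (volume.restrict (e.target ∩ e.symm ⁻¹' B)) :=
  ((m.continuousOn_exp he).mono inter_subset_left).aemeasurable
    (measurableSet_target_inter_preimage e hB)

theorem SmoothMeasure.setLIntegral_eq {e : OpenPartialHomeomorph M (Model d)} (he : IsChart e)
    {B : Set M} (hB : MeasurableSet B) (hBe : B ⊆ e.source) {G : M → ℝ≥0∞} (hG : Measurable G) :
    ∫⁻ x in B, G x ∂m.measure = ∫⁻ z in e.target ∩ e.symm ⁻¹' B,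
      ENNReal.ofReal (Real.exp (m.logDensity e z)) * G (e.symm z) := by
  have hs := aemeasurable_symm e (measurableSet_target_inter_preimage e hB) inter_subset_left
  rw [m.restrict_eq_map he hB hBe, lintegral_map' hG.aemeasurable
    (hs.mono_ac (withDensity_absolutelyContinuous _ _)),
    lintegral_withDensity_eq_lintegral_mul₀ (m.aemeasurable_density he hB)
      (g := fun z => G (e.symm z)) (hG.comp_aemeasurable hs)]
  rfl

/-- The integral over the level set `{x⁰ = t}` of a chart of the function `G` times the density. -/
def levelIntegral (e : OpenPartialHomeomorph M (Model d)) (B : Set M) (G : M → ℝ≥0∞) (t : ℝ) :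
    ℝ≥0∞ :=
  ∫⁻ y in levelSet e t B, ENNReal.ofReal (Real.exp (m.logDensity e (levelPoint t y))) *
    G (e.symm (levelPoint t y))

theorem levelIntegral_eq (e : OpenPartialHomeomorph M (Model d)) {B : Set M} (hB : MeasurableSet B)
    (G : M → ℝ≥0∞) (t : ℝ) : levelIntegral m e B G t =
      ∫⁻ y, (e.target ∩ e.symm ⁻¹' B).indicator (fun z =>
        ENNReal.ofReal (Real.exp (m.logDensity e z)) * G (e.symm z)) (levelPoint t y) := by
  rw [levelIntegral, ← lintegral_indicator (measurableSet_levelSet e t hB)]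
  rfl

/-- Fubini's theorem in a chart, and the measurability of the inner integral. -/
theorem coarea_chart {e : OpenPartialHomeomorph M (Model d)} (he : IsChart e)
    {B : Set M} (hB : MeasurableSet B) (hBe : B ⊆ e.source) {G : M → ℝ≥0∞} (hG : Measurable G) :
    AEMeasurable (levelIntegral m e B G) volume ∧
      ∫⁻ t, levelIntegral m e B G t = ∫⁻ x in B, G x ∂m.measure := by
  have hT := measurableSet_target_inter_preimage e hB
  have hs := aemeasurable_symm e hT inter_subset_left
  set H : Model d → ℝ≥0∞ := (e.target ∩ e.symm ⁻¹' B).indicator (fun z =>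
        ENNReal.ofReal (Real.exp (m.logDensity e z)) * G (e.symm z)) with hH
  have hHm : AEMeasurable H volume := by
    rw [hH, aemeasurable_indicator_iff hT]
    exact (m.aemeasurable_density he hB).mul (hG.comp_aemeasurable hs)
  have hmp := measurePreserving_levelPoint d
  have hHm' : AEMeasurable (fun q : ℝ × EuclideanSpace ℝ (Fin d) => H (levelPoint q.1 q.2))
      (volume.prod volume) :=
    hHm.comp_quasiMeasurePreserving hmp.quasiMeasurePreserving
  have hK : levelIntegral m e B G = fun t => ∫⁻ y, H (levelPoint t y) :=
    funext fun t => levelIntegral_eq m e hB G t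
  rw [hK]
  refine ⟨hHm'.lintegral_prod_right', ?_⟩
  rw [m.setLIntegral_eq he hB hBe hG, ← lintegral_indicator hT, ← hH, ← lintegral_prod _ hHm',
    ← hmp.map_eq, lintegral_map' _ hmp.measurable.aemeasurable]
  · rfl
  · rwa [hmp.map_eq]

theorem levelIntegral_mul {e : OpenPartialHomeomorph M (Model d)} {u : M → ℝ}
    (heu : ∀ z ∈ e.source, e z 0 = u z) {B : Set M} (hB : MeasurableSet B)
    (G : M → ℝ≥0∞) (w : ℝ → ℝ≥0∞) (hw : ∀ t, w t ≠ ⊤) (t : ℝ) :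
    w t * levelIntegral m e B G t = levelIntegral m e B (fun x => w (u x) * G x) t := by
  rw [levelIntegral, levelIntegral, ← lintegral_const_mul' _ _ (hw t)]
  refine setLIntegral_congr_fun (measurableSet_levelSet e t hB) fun y hy => ?_
  have : u (e.symm (levelPoint t y)) = t := by
    rw [← heu _ (e.map_target hy.1), e.right_inv hy.1, levelPoint_zero_coord]
  simp only [this]
  ring

variable (F : Metric d M)

/-- The area of a regular level set is at most the sum of the contributions of adapted charts. -/
theorem area_le_tsum {u : M → ℝ} (hu : ContMDiff (𝓡 (d + 1)) 𝓘(ℝ, ℝ) ∞ u) {t : ℝ}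
    (ht : ∀ x, u x = t → differential (d := d) u x ≠ 0) {ι : Type} [Countable ι]
    {e : ι → OpenPartialHomeomorph M (Model d)} (he : ∀ i, IsChart (e i))
    (heu : ∀ i, ∀ z ∈ (e i).source, e i z 0 = u z) {B : ι → Set M}
    (hB : ∀ i, MeasurableSet (B i)) (hBe : ∀ i, B i ⊆ (e i).source)
    (hcover : {x | u x = t} ⊆ ⋃ i, B i) :
    area m (F.unitNormal {x | u x = t} {x | t < u x}) {x | u x = t} ≤
      ∑' i, levelIntegral m (e i) (B i)
        (fun x => ENNReal.ofReal (F.dual x (differential u x))) t := by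
  set n := F.unitNormal {x | u x = t} {x | t < u x} with hn
  let k : ι → EuclideanSpace ℝ (Fin d) → ℝ≥0∞ := fun i y =>
    ENNReal.ofReal (Real.exp (m.logDensity (e i) (levelPoint t y))) *
      ENNReal.ofReal (F.dual ((e i).symm (levelPoint t y))
        (differential u ((e i).symm (levelPoint t y))))
  -- `area` is the total mass of a supremum of measures, so one measure dominating every slice area
  -- element is enough. The sum of the `ν i`, carried by the adapted pieces, is such a measure.
  let ν : ι → Measure M := fun i => ((volume.restrict (levelSet (e i) t (B i))).withDensity
    (k i)).map fun y => (e i).symm (levelPoint t y)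
  have hν : ∀ i A, MeasurableSet A → ν i A = ∫⁻ y in levelSet (e i) t (A ∩ B i), k i y := by
    intro i A hA
    have hL := measurableSet_levelSet (e i) t (hB i)
    have hm : AEMeasurable (fun y => (e i).symm (levelPoint t y))
        (volume.restrict (levelSet (e i) t (B i))) :=
      ((e i).symm.continuousOn.comp (continuous_levelPoint.comp
        (Continuous.prodMk_right t)).continuousOn fun y hy => hy.1).aemeasurable hL
    rw [Measure.map_apply_of_aemeasurable (hm.mono_ac (withDensity_absolutelyContinuous _ _)) hA,
      withDensity_apply', Measure.restrict_restrict' hL]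
    congr 2
    ext y
    simp only [levelSet, mem_inter_iff, mem_preimage, mem_ofPred_eq]
    tauto
  have hle : (⨆ (e' : OpenPartialHomeomorph M (Model d)) (_ : IsSliceChart {x | u x = t} e'),
      sliceArea m n e') ≤ Measure.sum ν := by
    refine iSup₂_le fun e' he' => Measure.le_iff.2 fun A hA => ?_
    have hU : MeasurableSet (⋃ i, B i) := MeasurableSet.iUnion hB
    -- The area element is concentrated on the level set, which the pieces cover.
    have h0 : sliceArea m n e' (A \ ⋃ i, B i) = 0 :=
      sliceArea_eq_zero m he' n (hA.diff hU) (disjoint_left.2 fun x hx hxt => hx.2 (hcover hxt))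
    have hAB : A = (A \ ⋃ i, B i) ∪ ⋃ i, A ∩ B i := by
      rw [← inter_iUnion, sdiff_union_inter]
    calc sliceArea m n e' A ≤ sliceArea m n e' (A \ ⋃ i, B i) + sliceArea m n e' (⋃ i, A ∩ B i) := by
          conv_lhs => rw [hAB]
          exact measure_union_le _ _
      _ ≤ ∑' i, sliceArea m n e' (A ∩ B i) := by
          rw [h0, zero_add]
          exact measure_iUnion_le _
      _ ≤ ∑' i, ν i A := by
          refine ENNReal.tsum_le_tsum fun i => ?_
          rw [hν i A hA]
          refine (sliceArea_le m (he i) (heu i) he' n (hA.inter (hB i))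
            (inter_subset_right.trans (hBe i))).trans ?_
          refine setLIntegral_mono' (measurableSet_levelSet _ _ (hA.inter (hB i))) fun y hy => ?_
          have hux : u ((e i).symm (levelPoint t y)) = t := by
            rw [← heu i _ ((e i).map_target hy.1), (e i).right_inv hy.1, levelPoint_zero_coord]
          simp only [k]
          rw [← ENNReal.ofReal_mul (Real.exp_pos _).le]
          gcongr
          exact F.abs_differential_unitNormal_le hu hux (ht _ hux)
      _ = Measure.sum ν A := (Measure.sum_apply _ hA).symm
  refine (hle univ).trans ?_
  rw [Measure.sum_apply _ MeasurableSet.univ]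
  refine ENNReal.tsum_le_tsum fun i => ?_
  rw [hν i _ MeasurableSet.univ, univ_inter]
  exact le_rfl

/-- The set of regular points is partitioned into pieces of adapted charts. -/
theorem exists_adapted_partition [SecondCountableTopology M] {u : M → ℝ}
    (hu : ContMDiff (𝓡 (d + 1)) 𝓘(ℝ, ℝ) ∞ u) :
    ∃ (ι : Type) (_ : Countable ι) (e : ι → OpenPartialHomeomorph M (Model d)) (B : ι → Set M),
      (∀ i, IsChart (e i)) ∧ (∀ i, ∀ z ∈ (e i).source, e i z 0 = u z) ∧
      (∀ i, MeasurableSet (B i)) ∧ (∀ i, B i ⊆ (e i).source) ∧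
      Pairwise (Function.onFun Disjoint B) ∧
      {x | differential (d := d) u x ≠ 0} ⊆ ⋃ i, B i := by
  rcases {x | differential (d := d) u x ≠ 0}.eq_empty_or_nonempty with hR | ⟨x₁, hx₁⟩
  · refine ⟨Empty, inferInstance, Empty.elim, Empty.elim, by simp, by simp, by simp, by simp,
      fun i => i.elim, ?_⟩
    simp [hR]
  · have : Nonempty (OpenPartialHomeomorph M (Model d)) := ⟨chartAt (Model d) x₁⟩
    have h := fun x (hx : x ∈ {x | differential (d := d) u x ≠ 0}) => exists_adapted_chart hu hx
    choose! e he hxe heu using h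
    obtain ⟨c, hcR, hcc, hc⟩ := TopologicalSpace.countable_cover_nhdsWithin
      (fun x hx => mem_nhdsWithin_of_mem_nhds ((e x).open_source.mem_nhds (hxe x hx)))
    have hne : c.Nonempty := by
      obtain ⟨x, hx, -⟩ := mem_iUnion₂.1 (hc hx₁)
      exact ⟨x, hx⟩
    obtain ⟨f, rfl⟩ := hcc.exists_eq_range hne
    have hf : ∀ i, f i ∈ {x | differential (d := d) u x ≠ 0} := fun i => hcR (mem_range_self i)
    refine ⟨ℕ, inferInstance, fun i => e (f i), disjointed fun i => (e (f i)).source,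
      fun i => he _ (hf i), fun i => heu _ (hf i),
      fun i => MeasurableSet.disjointed (fun i => (e (f i)).open_source.measurableSet) i,
      fun i => disjointed_subset _ i, disjoint_disjointed _, ?_⟩
    rw [iUnion_disjointed]
    simpa using hc

theorem volume_critical_values_manifold [SecondCountableTopology M] {u : M → ℝ}
    (hu : ContMDiff (𝓡 (d + 1)) 𝓘(ℝ, ℝ) ∞ u) :
    volume (u '' {x | differential (d := d) u x = 0}) = 0 := by
  refine volume_image_eq_zero_of_locally fun x₀ _ => ?_
  set e := chartAt (Model d) x₀
  refine ⟨{x | differential (d := d) u x = 0} ∩ e.source,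
    inter_mem_nhdsWithin _ (e.open_source.mem_nhds (mem_chart_source _ x₀)), ?_⟩
  refine measure_mono_null ?_ (volume_critical_values (d + 1) e.open_target
    (contDiffOn_comp_symm (isChart_chartAt x₀) hu))
  rintro _ ⟨x, ⟨hx, hxe⟩, rfl⟩
  refine ⟨e x, ⟨e.map_source hxe, ?_⟩, congrArg u (e.left_inv hxe)⟩
  rw [← differential_comp_tangentCoordChange hxe hu.contMDiffAt]
  have hx' : differential (d := d) u x = 0 := hx
  rw [hx']
  exact ContinuousLinearMap.zero_comp _

/-- The coarea inequality for the areas of the level sets with respect to the normals pointing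
towards increasing values. -/
theorem coarea_le [SecondCountableTopology M] {u : M → ℝ}
    (hu : ContMDiff (𝓡 (d + 1)) 𝓘(ℝ, ℝ) ∞ u) {w : ℝ → ℝ≥0∞} (hw : Measurable w)
    (hw' : ∀ t, w t ≠ ⊤) :
    ∫⁻ t, w t * area m (F.unitNormal {x | u x = t} {x | t < u x}) {x | u x = t} ≤
      ∫⁻ x, w (u x) * ENNReal.ofReal (F.dual x (differential u x)) ∂m.measure := by
  obtain ⟨ι, _, e, B, he, heu, hB, hBe, hdisj, hcover⟩ := exists_adapted_partition hu
  set G : M → ℝ≥0∞ := fun x => ENNReal.ofReal (F.dual x (differential u x))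
  have hG : Measurable fun x => w (u x) * G x :=
    (hw.comp hu.continuous.measurable).mul (F.measurable_dual_differential hu)
  have hreg : ∀ᵐ t, ∀ x, u x = t → differential (d := d) u x ≠ 0 := by
    have := compl_mem_ae_iff.2 (volume_critical_values_manifold hu)
    filter_upwards [this] with t ht x hxt hx
    exact ht ⟨x, hx, hxt⟩
  calc ∫⁻ t, w t * area m (F.unitNormal {x | u x = t} {x | t < u x}) {x | u x = t}
      ≤ ∫⁻ t, ∑' i, levelIntegral m (e i) (B i) (fun x => w (u x) * G x) t := by
        refine lintegral_mono_ae ?_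
        filter_upwards [hreg] with t ht
        simp_rw [← fun i => levelIntegral_mul m (heu i) (hB i) G w hw' t]
        rw [ENNReal.tsum_mul_left]
        gcongr
        exact area_le_tsum m F hu ht he heu hB hBe fun x hx => hcover (ht x hx)
    _ = ∑' i, ∫⁻ t, levelIntegral m (e i) (B i) (fun x => w (u x) * G x) t :=
        lintegral_tsum fun i => (coarea_chart m (he i) (hB i) (hBe i) hG).1
    _ = ∑' i, ∫⁻ x in B i, w (u x) * G x ∂m.measure := by
        simp_rw [fun i => (coarea_chart m (he i) (hB i) (hBe i) hG).2]
    _ = ∫⁻ x in ⋃ i, B i, w (u x) * G x ∂m.measure := (lintegral_iUnion hB hdisj _).symm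
    _ ≤ ∫⁻ x, w (u x) * G x ∂m.measure := setLIntegral_le_lintegral _ _

end Coarea

/-! ### Level sets as competitors in Cheeger's constant -/

section LevelSets

variable {d : ℕ} {M : Type*} [TopologicalSpace M] [ChartedSpace (Model d) M]
  [IsManifold (𝓡 (d + 1)) ∞ M]

/-- A regular level set divides the manifold into the sublevel and the superlevel set. -/
theorem divides_of_regular {u : M → ℝ} (hu : ContMDiff (𝓡 (d + 1)) 𝓘(ℝ, ℝ) ∞ u) {t : ℝ}
    (ht : ∀ x, u x = t → differential (d := d) u x ≠ 0) (h₁ : {x | u x < t}.Nonempty)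
    (h₂ : {x | t < u x}.Nonempty) : Divides d {x | u x = t} {x | u x < t} {x | t < u x} := by
  have hc := hu.continuous
  have hv : ∀ x, u x = t → ∃ v : Model d, 0 < differential u x v := fun x hx => by
    by_contra! hcon
    refine ht x hx (ContinuousLinearMap.ext fun v => le_antisymm (hcon v) ?_)
    have := hcon (-v)
    rw [show differential u x (-v : Model d) = - differential u x v from map_neg _ _] at this
    exact neg_nonpos.1 this
  refine ⟨fun x hx => ?_, isOpen_lt hc continuous_const, isOpen_lt continuous_const hc, h₁, h₂,
    ?_, ?_, (frontier_lt_subset_eq hc continuous_const).antisymm fun x hx => ?_,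
    Subset.antisymm (fun x hx => (frontier_lt_subset_eq continuous_const hc hx).symm)
      fun x hx => ?_⟩
  · obtain ⟨e, he, hxe, -⟩ := exists_sliceChart hu (ht x hx)
    have hx' : u x = t := hx
    rw [hx'] at he
    exact ⟨e, he, hxe⟩
  · exact disjoint_left.2 fun x h h' => lt_asymm (show u x < t from h) h'
  · ext x
    exact lt_or_lt_iff_ne (a := u x) (b := t)
  · have hx' : u x = t := hx
    rw [frontier, (isOpen_lt hc continuous_const).interior_eq]
    refine ⟨?_, fun h : u x < t => h.ne hx'⟩
    obtain ⟨v, hv⟩ := hv x hx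
    have hneg : differential u x (-v : Model d) < 0 := by
      rw [show differential u x (-v : Model d) = - differential u x v from map_neg _ _]
      exact neg_neg_of_pos hv
    refine mem_closure_of_tendsto (tendsto_chart_line x (-v)) ?_
    filter_upwards [eventually_lt_of_differential_neg hu hneg] with s hs
    exact hs.trans_eq hx'
  · have hx' : u x = t := hx
    rw [frontier, (isOpen_lt continuous_const hc).interior_eq]
    refine ⟨?_, fun h : t < u x => h.ne' hx'⟩
    obtain ⟨v, hv⟩ := hv x hx
    refine mem_closure_of_tendsto (tendsto_chart_line x v) ?_
    filter_upwards [eventually_lt_of_differential_pos hu hv] with s hs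
    exact hx'.symm.trans_lt hs

/-- Use the level set as a competitor, with the sublevel set as `D₁`. The minimum of the two areas
is bounded by the one whose normal points into the superlevel set. If either side is empty the
left-hand side vanishes. -/
theorem cheeger_mul_le_area [MeasurableSpace M] (F : Metric d M) (m : SmoothMeasure d M)
    {u : M → ℝ} (hu : ContMDiff (𝓡 (d + 1)) 𝓘(ℝ, ℝ) ∞ u) {t : ℝ}
    (ht : ∀ x, u x = t → differential (d := d) u x ≠ 0) :
    cheeger F m * min (m.measure {x | u x < t}) (m.measure {x | t < u x}) ≤
      area m (F.unitNormal {x | u x = t} {x | t < u x}) {x | u x = t} := by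
  rcases {x | u x < t}.eq_empty_or_nonempty with h₁ | h₁
  · simp [h₁]
  rcases {x | t < u x}.eq_empty_or_nonempty with h₂ | h₂
  · simp [h₂]
  have hdiv := divides_of_regular hu ht h₁ h₂
  refine ENNReal.mul_le_of_le_div ?_
  unfold cheeger
  refine iInf_le_of_le _ (iInf_le_of_le _ (iInf_le_of_le _ (iInf_le_of_le hdiv ?_)))
  gcongr
  exact min_le_left _ _

theorem SmoothMeasure.isFiniteMeasure [CompactSpace M] [MeasurableSpace M]
    (m : SmoothMeasure d M) : IsFiniteMeasure m.measure := by
  refine ⟨isCompact_univ.measure_lt_top_of_nhdsWithin fun x _ => ?_⟩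
  rw [nhdsWithin_univ]
  have he := isChart_chartAt (d := d) x
  have hxe : x ∈ (chartAt (Model d) x).source := mem_chart_source _ x
  set e := chartAt (Model d) x
  let V : Set (Model d) := (e.target ∩ m.logDensity e ⁻¹' Iio (m.logDensity e (e x) + 1)) ∩
    Metric.ball (e x) 1
  have hV : IsOpen V := ((m.smooth e he).continuousOn.isOpen_inter_preimage e.open_target
    isOpen_Iio).inter Metric.isOpen_ball
  have hxV : e x ∈ V := ⟨⟨e.map_source hxe, by simp⟩, Metric.mem_ball_self one_pos⟩
  refine ⟨e.source ∩ e ⁻¹' V, (e.isOpen_inter_preimage hV).mem_nhds ⟨hxe, hxV⟩, ?_⟩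
  have hsub : e.source ∩ e ⁻¹' V ⊆ e.symm '' V := fun z hz => ⟨e z, hz.2, e.left_inv hz.1⟩
  refine (measure_mono hsub).trans_lt ?_
  rw [m.chart_eq e he V hV.measurableSet fun z hz => hz.1.1]
  calc ∫⁻ z in V, ENNReal.ofReal (Real.exp (m.logDensity e z))
      ≤ ∫⁻ z in V, ENNReal.ofReal (Real.exp (m.logDensity e (e x) + 1)) := by
        refine setLIntegral_mono' hV.measurableSet fun z hz => ?_
        gcongr
        exact le_of_lt hz.1.2
    _ = ENNReal.ofReal (Real.exp (m.logDensity e (e x) + 1)) * volume V := setLIntegral_const _ _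
    _ < ⊤ := ENNReal.mul_lt_top ENNReal.ofReal_lt_top
        ((measure_mono inter_subset_right).trans_lt Metric.isBounded_ball.measure_lt_top)

end LevelSets

/-! ### Cheeger's inequality for smooth functions -/

section Smooth

/-- The layer-cake formula for the positive and negative parts. The substitution `t ↦ -t` in the
second brings both into the form of one weight `p |t|^(p-1)` integrated over the levels of `v`, as
in the coarea inequality. -/
theorem lintegral_abs_rpow_eq {X : Type*} [MeasurableSpace X] (μ : Measure X) {v : X → ℝ}
    (hv : Measurable v) {p : ℝ} (hp : 0 < p) :
    ∫⁻ x, ENNReal.ofReal (|v x| ^ p) ∂μ =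
      (∫⁻ t in Ioi 0, ENNReal.ofReal (p * |t| ^ (p - 1)) * μ {x | t < v x}) +
        ∫⁻ t in Iio 0, ENNReal.ofReal (p * |t| ^ (p - 1)) * μ {x | v x < t} := by
  have key : ∀ {w : X → ℝ}, Measurable w → ∫⁻ x, ENNReal.ofReal (max (w x) 0 ^ p) ∂μ =
      ∫⁻ t in Ioi 0, ENNReal.ofReal (p * |t| ^ (p - 1)) * μ {x | t < w x} := by
    intro w hw
    rw [lintegral_rpow_eq_lintegral_meas_lt_mul (f := fun x => max (w x) 0) μ
      (Eventually.of_forall fun x => le_max_right _ _) (hw.max measurable_const).aemeasurable hp, ← lintegral_const_mul' _ _ ENNReal.ofReal_ne_top]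
    refine setLIntegral_congr_fun measurableSet_Ioi fun t ht => ?_
    have ht' : 0 < t := ht
    have hset : {a | t < max (w a) 0} = {x | t < w x} := by
      ext x
      simp [ht'.le]
    simp only [hset, abs_of_pos ht']
    rw [ENNReal.ofReal_mul hp.le]
    ring
  have hsplit : ∀ x, ENNReal.ofReal (|v x| ^ p) =
      ENNReal.ofReal (max (v x) 0 ^ p) + ENNReal.ofReal (max (-v x) 0 ^ p) := fun x => by
    rcases le_total 0 (v x) with h | h
    · rw [abs_of_nonneg h, max_eq_left h, max_eq_right (by linarith), Real.zero_rpow hp.ne']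
      simp
    · rw [abs_of_nonpos h, max_eq_right h, max_eq_left (by linarith), Real.zero_rpow hp.ne']
      simp
  simp_rw [hsplit]
  have hm : Measurable fun x => ENNReal.ofReal (max (v x) 0 ^ p) :=
    ENNReal.measurable_ofReal.comp ((hv.max measurable_const).pow_const p)
  rw [lintegral_add_left hm, key hv, key (w := fun x => -v x) hv.neg]
  congr 1
  have hneg := (Measure.measurePreserving_neg (volume : Measure ℝ)).setLIntegral_comp_preimage_emb
    (MeasurableEquiv.neg ℝ).measurableEmbedding
    (fun t => ENNReal.ofReal (p * |t| ^ (p - 1)) * μ {x | v x < t}) (Iio 0)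
  rw [← hneg]
  have hpre : (Neg.neg ⁻¹' Iio 0 : Set ℝ) = Ioi 0 := by
    ext t
    simp
  rw [hpre]
  refine lintegral_congr fun t => ?_
  rw [abs_neg]
  congr 2
  ext x
  exact lt_neg (a := t) (b := v x)

variable {d : ℕ} {M : Type*} [TopologicalSpace M] [ChartedSpace (Model d) M]
  [IsManifold (𝓡 (d + 1)) ∞ M] [MeasurableSpace M] [BorelSpace M] [SecondCountableTopology M]
  (F : Metric d M) (m : SmoothMeasure d M)

/-- Cheeger's inequality in `L¹` for `|v|^p` if `0` is a median of `v`. -/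
theorem cheeger_mul_lintegral_le {v : M → ℝ} (hv : ContMDiff (𝓡 (d + 1)) 𝓘(ℝ, ℝ) ∞ v)
    {p : ℝ} (hp : 1 < p)
    (hpos : ∀ t, 0 < t → m.measure {x | t < v x} ≤ m.measure {x | v x < t})
    (hneg : ∀ t, t < 0 → m.measure {x | v x < t} ≤ m.measure {x | t < v x}) :
    cheeger F m * ∫⁻ x, ENNReal.ofReal (|v x| ^ p) ∂m.measure ≤
      ∫⁻ x, ENNReal.ofReal (p * |v x| ^ (p - 1)) * ENNReal.ofReal (F.dual x (differential v x))
        ∂m.measure := by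
  have hp0 : 0 < p := by linarith
  set w : ℝ → ℝ≥0∞ := fun t => ENNReal.ofReal (p * |t| ^ (p - 1)) with hwdef
  have hw : Measurable w := by
    refine ENNReal.measurable_ofReal.comp ((Measurable.pow_const ?_ _).const_mul _)
    exact continuous_abs.measurable
  set g : ℝ → ℝ≥0∞ := fun t =>
    w t * min (m.measure {x | v x < t}) (m.measure {x | t < v x}) with hg
  have hreg : ∀ᵐ t, ∀ x, v x = t → differential (d := d) v x ≠ 0 := by
    have := compl_mem_ae_iff.2 (volume_critical_values_manifold hv)
    filter_upwards [this] with t ht x hxt hx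
    exact ht ⟨x, hx, hxt⟩
  have hI : ∫⁻ x, ENNReal.ofReal (|v x| ^ p) ∂m.measure ≤ ∫⁻ t, g t := by
    rw [lintegral_abs_rpow_eq _ hv.continuous.measurable hp0]
    have h1 : ∫⁻ t in Ioi 0, w t * m.measure {x | t < v x} = ∫⁻ t in Ioi 0, g t :=
      setLIntegral_congr_fun measurableSet_Ioi fun t ht => by
        simp only [hg]
        rw [min_eq_right (hpos t ht)]
    have h2 : ∫⁻ t in Iio 0, w t * m.measure {x | v x < t} = ∫⁻ t in Iio 0, g t :=
      setLIntegral_congr_fun measurableSet_Iio fun t ht => by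
        simp only [hg]
        rw [min_eq_left (hneg t ht)]
    have hdisj : Disjoint (Ioi (0 : ℝ)) (Iio 0) := disjoint_left.2 fun t h h' =>
      lt_asymm (mem_Ioi.1 h) (mem_Iio.1 h')
    rw [h1, h2, ← lintegral_union measurableSet_Iio hdisj]
    exact setLIntegral_le_lintegral _ _
  calc cheeger F m * ∫⁻ x, ENNReal.ofReal (|v x| ^ p) ∂m.measure
      ≤ cheeger F m * ∫⁻ t, g t := by gcongr
    _ ≤ ∫⁻ t, cheeger F m * g t := lintegral_const_mul_le _ _
    _ ≤ ∫⁻ t, w t * area m (F.unitNormal {x | v x = t} {x | t < v x}) {x | v x = t} := by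
        refine lintegral_mono_ae ?_
        filter_upwards [hreg] with t ht
        have := cheeger_mul_le_area F m hv ht
        simp only [hg]
        rw [mul_left_comm]
        gcongr
    _ ≤ _ := coarea_le m F hv hw fun t => ENNReal.ofReal_ne_top

theorem lintegral_ofReal_abs_rpow_lt_top [CompactSpace M] {v : M → ℝ} (hv : Continuous v) {p : ℝ}
    (hp : 0 ≤ p) :
    ∫⁻ x, ENNReal.ofReal (|v x| ^ p) ∂m.measure < ⊤ := by
  have := m.isFiniteMeasure
  obtain ⟨C, hC⟩ := isCompact_univ.exists_bound_of_continuousOn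
    (hv.abs.rpow_const fun _ => Or.inr hp).continuousOn
  refine (lintegral_mono fun x => ENNReal.ofReal_le_ofReal
    ((le_abs_self _).trans (hC x (mem_univ x)))).trans_lt ?_
  rw [lintegral_const]
  exact ENNReal.mul_lt_top ENNReal.ofReal_lt_top (measure_lt_top _ _)

/-- Apply Hölder with exponents `p` and `p / (p - 1)` to the `L¹` inequality and divide by `I ^ (1 /
q)`. Division is legitimate because `I` is finite by compactness and the case `I = 0` is trivial. -/
theorem cheeger_mul_norm_le [CompactSpace M] {v : M → ℝ}
    (hv : ContMDiff (𝓡 (d + 1)) 𝓘(ℝ, ℝ) ∞ v) {p : ℝ} (hp : 1 < p)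
    (hpos : ∀ t, 0 < t → m.measure {x | t < v x} ≤ m.measure {x | v x < t})
    (hneg : ∀ t, t < 0 → m.measure {x | v x < t} ≤ m.measure {x | t < v x}) :
    cheeger F m * (∫⁻ x, ENNReal.ofReal (|v x|) ^ p ∂m.measure) ^ (1 / p) ≤ ENNReal.ofReal p *
      (∫⁻ x, ENNReal.ofReal (F.dual x (differential v x)) ^ p ∂m.measure) ^ (1 / p) := by
  have hp0 : 0 < p := by linarith
  have hpq : p.HolderConjugate (p / (p - 1)) := Real.HolderConjugate.conjExponent hp
  set q := p / (p - 1)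
  have hpow : ∀ x, ENNReal.ofReal (|v x|) ^ p = ENNReal.ofReal (|v x| ^ p) := fun x =>
    ENNReal.ofReal_rpow_of_nonneg (abs_nonneg _) hp0.le
  simp_rw [hpow]
  set I := ∫⁻ x, ENNReal.ofReal (|v x| ^ p) ∂m.measure with hI
  set J := ∫⁻ x, ENNReal.ofReal (F.dual x (differential v x)) ^ p ∂m.measure
  have hItop : I ≠ ⊤ := (lintegral_ofReal_abs_rpow_lt_top m hv.continuous hp0.le).ne
  rcases eq_or_ne I 0 with hI0 | hI0
  · rw [hI0, ENNReal.zero_rpow_of_pos (by positivity)]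
    simp
  have hmain : cheeger F m * I ≤ ENNReal.ofReal p * J ^ (1 / p) * I ^ (1 / q) := by
    refine (cheeger_mul_lintegral_le F m hv hp hpos hneg).trans ?_
    simp_rw [ENNReal.ofReal_mul hp0.le, mul_assoc]
    rw [lintegral_const_mul' _ _ ENNReal.ofReal_ne_top]
    gcongr
    have hD := F.measurable_dual_differential hv
    have hV : Measurable fun x => ENNReal.ofReal (|v x| ^ (p - 1)) :=
      ENNReal.measurable_ofReal.comp (hv.continuous.measurable.abs.pow_const _)
    have hh := ENNReal.lintegral_mul_le_Lp_mul_Lq m.measure hpq hD.aemeasurable hV.aemeasurable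
    have hIq : ∫⁻ x, ENNReal.ofReal (|v x| ^ (p - 1)) ^ q ∂m.measure = I := by
      refine lintegral_congr fun x => ?_
      rw [ENNReal.ofReal_rpow_of_nonneg (by positivity) hpq.symm.nonneg,
        ← Real.rpow_mul (abs_nonneg _)]
      congr 2
      exact mul_div_cancel₀ _ (by linarith : p - 1 ≠ 0)
    rw [hIq] at hh
    refine le_trans (le_of_eq (lintegral_congr fun x => ?_)) hh
    rw [Pi.mul_apply, mul_comm]
  have hIsplit : I = I ^ (1 / p) * I ^ (1 / q) := by
    rw [← ENNReal.rpow_add _ _ hI0 hItop, one_div, one_div, hpq.inv_add_inv_eq_one,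
      ENNReal.rpow_one]
  have hq0 : I ^ (1 / q) ≠ 0 := by simp [ENNReal.rpow_eq_zero_iff, hI0, hItop]
  have hqt : I ^ (1 / q) ≠ ⊤ := by simp [ENNReal.rpow_eq_top_iff, hI0, hItop]
  refine (ENNReal.mul_le_mul_iff_left hq0 hqt).1 ?_
  rw [mul_assoc, ← hIsplit]
  exact hmain

/-- The median is the infimum of the levels `t` with `m{u > t} ≤ m{u < t}`. These form an upward
closed set, bounded below because `m` is nonzero. The two sides are compared with each other rather
than with half the total mass, so level sets of positive measure cause no difficulty. -/
theorem exists_median [CompactSpace M] [Nonempty M] {u : M → ℝ} (hu : Continuous u)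
    (hm : m.measure ≠ 0) : ∃ c : ℝ,
    (∀ t, c < t → m.measure {x | t < u x} ≤ m.measure {x | u x < t}) ∧
    (∀ t, t < c → m.measure {x | u x < t} ≤ m.measure {x | t < u x}) := by
  let S : Set ℝ := {t | m.measure {x | t < u x} ≤ m.measure {x | u x < t}}
  have hup : ∀ s ∈ S, ∀ t, s ≤ t → t ∈ S := fun s hs t hst =>
    (measure_mono fun x hx => hst.trans_lt hx).trans
      (le_trans hs (measure_mono fun x hx => lt_of_lt_of_le hx hst))
  obtain ⟨a, ha⟩ := (isCompact_range hu).bddBelow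
  obtain ⟨b, hb⟩ := (isCompact_range hu).bddAbove
  have hne : S.Nonempty := by
    refine ⟨b, ?_⟩
    have : {x | b < u x} = ∅ := eq_empty_of_forall_notMem fun x hx =>
      not_lt_of_ge (hb (mem_range_self x)) hx
    change m.measure {x | b < u x} ≤ _
    simp [this]
  have hbdd : BddBelow S := by
    refine ⟨a, fun t ht => ?_⟩
    by_contra! hta
    have h1 : {x | t < u x} = univ := eq_univ_of_forall fun x =>
      hta.trans_le (ha (mem_range_self x))
    have h2 : {x | u x < t} = ∅ := eq_empty_of_forall_notMem fun x hx =>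
      not_lt_of_ge (hta.le.trans (ha (mem_range_self x))) hx
    have ht' : m.measure {x | t < u x} ≤ m.measure {x | u x < t} := ht
    rw [h1, h2, measure_empty, nonpos_iff_eq_zero, Measure.measure_univ_eq_zero] at ht'
    exact hm ht'
  refine ⟨sInf S, fun t ht => ?_, fun t ht => ?_⟩
  · obtain ⟨s, hs, hst⟩ := exists_lt_of_csInf_lt hne ht
    exact hup s hs t hst.le
  · by_contra! hcon
    exact (csInf_le hbdd (show t ∈ S from hcon.le)).not_gt ht

/-- Cheeger's inequality for smooth functions. -/
theorem exists_cheeger_mul_norm_sub_le [CompactSpace M] [Nonempty M] {u : M → ℝ}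
    (hu : ContMDiff (𝓡 (d + 1)) 𝓘(ℝ, ℝ) ∞ u) (hm : m.measure ≠ 0) {p : ℝ} (hp : 1 < p) :
    ∃ c : ℝ, cheeger F m * (∫⁻ x, ENNReal.ofReal (|u x - c|) ^ p ∂m.measure) ^ (1 / p) ≤
      ENNReal.ofReal p *
      (∫⁻ x, ENNReal.ofReal (F.dual x (differential u x)) ^ p ∂m.measure) ^ (1 / p) := by
  obtain ⟨c, hc1, hc2⟩ := exists_median m hu.continuous hm
  refine ⟨c, ?_⟩
  have hv : ContMDiff (𝓡 (d + 1)) 𝓘(ℝ, ℝ) ∞ fun x => u x - c :=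
    hu.sub contMDiff_const
  have hd : ∀ x, differential (d := d) (fun x => u x - c) x = differential u x := fun x => by
    rw [differential_eq hv.contMDiffAt, differential_eq hu.contMDiffAt]
    exact fderiv_sub_const c
  have := cheeger_mul_norm_le F m hv hp (fun t ht => ?_) (fun t ht => ?_)
  · simp_rw [hd] at this
    exact this
  · simpa only [lt_sub_iff_add_lt, sub_lt_iff_lt_add] using hc1 (t + c) (by linarith)
  · simpa only [lt_sub_iff_add_lt, sub_lt_iff_lt_add] using hc2 (t + c) (by linarith)

end Smooth

/-! ### Minimality of the zero constant -/

/-- The graph of `|·|^p` lies above its tangents. -/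
theorem abs_rpow_sub_le_abs_sub_rpow {p : ℝ} (hp : 1 < p) (s c : ℝ) :
    |s| ^ p - p * c * (|s| ^ (p - 2) * s) ≤ |s - c| ^ p := by
  have hp0 : 0 < p := by linarith
  rcases eq_or_ne s 0 with rfl | hs
  · rw [abs_zero, Real.zero_rpow hp0.ne', mul_zero, mul_zero, sub_zero]
    positivity
  have hs' : 0 < |s| := abs_pos.2 hs
  have hpq : p.HolderConjugate (p / (p - 1)) := Real.HolderConjugate.conjExponent hp
  -- Young's inequality for `|s - c|` and `|s|^(p-1)`, whose conjugate power is `|s|^p`.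
  have hy := Real.young_inequality_of_nonneg (abs_nonneg (s - c))
    (Real.rpow_nonneg (abs_nonneg s) (p - 1)) hpq
  have hpm : p - 1 ≠ 0 := by linarith
  rw [← Real.rpow_mul (abs_nonneg s), mul_div_cancel₀ _ hpm] at hy
  have h1 : |s| ^ (p - 2) * s * s = |s| ^ p := by
    rw [mul_assoc, ← abs_mul_abs_self s, ← pow_two, ← Real.rpow_natCast, ← Real.rpow_add hs']
    norm_num
  have h2 : |s| ^ (p - 2) * |s| = |s| ^ (p - 1) := by
    nth_rw 2 [← Real.rpow_one |s|]
    rw [← Real.rpow_add hs']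
    congr 1
    ring
  have h3 : |s| ^ (p - 2) * s * (s - c) ≤ |s - c| * |s| ^ (p - 1) := by
    refine (le_abs_self _).trans (le_of_eq ?_)
    rw [abs_mul, abs_mul, abs_of_nonneg (Real.rpow_nonneg (abs_nonneg s) _), h2]
    ring
  have h4 : p * (|s - c| * |s| ^ (p - 1)) ≤ |s - c| ^ p + (p - 1) * |s| ^ p := by
    have := mul_le_mul_of_nonneg_left hy hp0.le
    refine this.trans (le_of_eq ?_)
    field_simp
  have h5 := mul_le_mul_of_nonneg_left h3 hp0.le
  nlinarith

/-- If `∫ |f|^{p-2} f = 0` then the constant closest to `f` in `L^p` is `0`. -/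
theorem lintegral_abs_rpow_le_of_mean_eq_zero {X : Type*} [MeasurableSpace X] {μ : Measure X}
    [IsFiniteMeasure μ] {p : ℝ} (hp : 1 < p) {f : X → ℝ} (hf : MemLp f (ENNReal.ofReal p) μ)
    (h0 : ∫ x, |f x| ^ (p - 2) * f x ∂μ = 0) (c : ℝ) :
    ∫⁻ x, ENNReal.ofReal (|f x|) ^ p ∂μ ≤ ∫⁻ x, ENNReal.ofReal (|f x - c|) ^ p ∂μ := by
  have hp0 : 0 < p := by linarith
  have hint : ∀ {g : X → ℝ}, MemLp g (ENNReal.ofReal p) μ → Integrable (fun x => |g x| ^ p) μ := by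
    intro g hg
    have := hg.integrable_norm_rpow (by simpa using hp0) ENNReal.ofReal_ne_top
    simpa [ENNReal.toReal_ofReal hp0.le] using this
  have h1 := hint hf
  have h2 : Integrable (fun x => |f x - c| ^ p) μ := hint (hf.sub (memLp_const c))
  have hm : AEStronglyMeasurable (fun x => |f x| ^ (p - 2) * f x) μ := by
    have hmeas : Measurable fun s : ℝ => |s| ^ (p - 2) * s :=
      (continuous_abs.measurable.pow_const _).mul measurable_id
    exact (hmeas.comp_aemeasurable hf.aestronglyMeasurable.aemeasurable).aestronglyMeasurable
  have h3 : Integrable (fun x => |f x| ^ (p - 2) * f x) μ := by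
    refine ((integrable_const (1 : ℝ)).add h1).mono' hm (Eventually.of_forall fun x => ?_)
    rw [Pi.add_apply, Real.norm_eq_abs, abs_mul,
      abs_of_nonneg (Real.rpow_nonneg (abs_nonneg (f x)) _)]
    rcases eq_or_ne (f x) 0 with hx | hx
    · rw [hx, abs_zero, mul_zero, Real.zero_rpow hp0.ne']
      norm_num
    have hx' : 0 < |f x| := abs_pos.2 hx
    have : |f x| ^ (p - 2) * |f x| = |f x| ^ (p - 1) := by
      nth_rw 2 [← Real.rpow_one |f x|]
      rw [← Real.rpow_add hx']
      congr 1
      ring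
    rw [this]
    rcases le_total |f x| 1 with hle | hle
    · have := Real.rpow_le_one hx'.le hle (by linarith : 0 ≤ p - 1)
      have h' : 0 ≤ |f x| ^ p := by positivity
      linarith
    · have := Real.rpow_le_rpow_of_exponent_le hle (by linarith : p - 1 ≤ p)
      linarith
  -- Integrate the tangent inequality; the linear term vanishes by `h0`.
  have hle : ∫ x, |f x| ^ p ∂μ ≤ ∫ x, |f x - c| ^ p ∂μ := by
    have := integral_mono (h1.sub (h3.const_mul (p * c))) h2
      fun x => abs_rpow_sub_le_abs_sub_rpow hp (f x) c
    simp only [Pi.sub_apply] at this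
    rw [integral_sub h1 (h3.const_mul (p * c)), integral_const_mul, h0, mul_zero, sub_zero] at this
    exact this
  simp_rw [ENNReal.ofReal_rpow_of_nonneg (abs_nonneg _) hp0.le]
  rw [← ofReal_integral_eq_lintegral_ofReal h1 (Eventually.of_forall fun x => by positivity),
    ← ofReal_integral_eq_lintegral_ofReal h2 (Eventually.of_forall fun x => by positivity)]
  exact ENNReal.ofReal_le_ofReal hle

/-! ### Passage to Sobolev functions -/

section Limit

variable {d : ℕ} {M : Type*} [TopologicalSpace M] [ChartedSpace (Model d) M]
  [IsManifold (𝓡 (d + 1)) ∞ M] [MeasurableSpace M] [BorelSpace M] [SecondCountableTopology M]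
  (F : Metric d M) (m : SmoothMeasure d M)

theorem measurableCovectorField_differential (μ : Measure M) {u : M → ℝ}
    (hu : ContMDiff (𝓡 (d + 1)) 𝓘(ℝ, ℝ) ∞ u) :
    MeasurableCovectorField (d := d) μ (fun x => differential u x) := fun x₀ =>
  (continuousOn_differential_tangentCoordChange hu x₀).aemeasurable
    (chartAt (Model d) x₀).open_source.measurableSet

theorem MeasurableCovectorField.sub {μ : Measure M}
    {α β : (x : M) → TangentSpace (𝓡 (d + 1)) x →L[ℝ] ℝ} (hα : MeasurableCovectorField μ α)
    (hβ : MeasurableCovectorField μ β) : MeasurableCovectorField μ (fun x => α x - β x) :=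
  fun x₀ => ((hα x₀).sub (hβ x₀)).congr (Eventually.of_forall fun _ => rfl)

/-- Apply the smooth inequality to the approximations, with medians depending on `k`, and let the
errors tend to zero. A finite `r` replaces the Cheeger constant, since the error `r * ε k` tends to
zero only for finite `r`. -/
theorem cheeger_mul_norm_le_of_isSobolev [CompactSpace M] [Nonempty M] (hm : m.measure ≠ 0)
    {p : ℝ} (hp : 1 < p)
    {f : M → ℝ} {α : (x : M) → TangentSpace (𝓡 (d + 1)) x →L[ℝ] ℝ} (hf : IsSobolev F m p f α)
    (h0 : ∫ x, |f x| ^ (p - 2) * f x ∂m.measure = 0) {r : NNReal}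
    (hr : (r : ℝ≥0∞) ≤ cheeger F m) :
    r * (∫⁻ x, ENNReal.ofReal (|f x|) ^ p ∂m.measure) ^ (1 / p) ≤ ENNReal.ofReal p *
      (∫⁻ x, ENNReal.ofReal (F.dual x (α x)) ^ p ∂m.measure) ^ (1 / p) := by
  have hp0 : 0 < p := by linarith
  have hpi : 0 < 1 / p := by positivity
  have := m.isFiniteMeasure
  obtain ⟨hfL, hα, u, hu, hlim1, hlim2⟩ := hf
  set ε : ℕ → ℝ≥0∞ := fun k => (∫⁻ x, ENNReal.ofReal (|u k x - f x|) ^ p ∂m.measure) ^ (1 / p)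
  set δ : ℕ → ℝ≥0∞ := fun k =>
    (∫⁻ x, ENNReal.ofReal (F.dual x (differential (u k) x - α x)) ^ p ∂m.measure) ^ (1 / p)
  have hε : Tendsto ε atTop (𝓝 0) := by
    simp_rw [← ENNReal.ofReal_rpow_of_nonneg (abs_nonneg _) hp0.le] at hlim1
    have := hlim1.ennrpow_const (1 / p)
    rwa [ENNReal.zero_rpow_of_pos hpi] at this
  have hδ : Tendsto δ atTop (𝓝 0) := by
    simp_rw [← ENNReal.ofReal_rpow_of_nonneg (F.dual_nonneg _ _) hp0.le] at hlim2
    have := hlim2.ennrpow_const (1 / p)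
    rwa [ENNReal.zero_rpow_of_pos hpi] at this
  set A := (∫⁻ x, ENNReal.ofReal (|f x|) ^ p ∂m.measure) ^ (1 / p)
  set D := (∫⁻ x, ENNReal.ofReal (F.dual x (α x)) ^ p ∂m.measure) ^ (1 / p)
  have hk : ∀ k, r * A ≤ ENNReal.ofReal p * (D + δ k) + r * ε k := by
    intro k
    obtain ⟨c, hc⟩ := exists_cheeger_mul_norm_sub_le F m (hu k) hm hp
    have hfm : AEMeasurable f m.measure := hfL.aestronglyMeasurable.aemeasurable
    have hum : AEMeasurable (u k) m.measure := (hu k).continuous.measurable.aemeasurable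
    -- Removing the median `c` from the norm of `f` costs nothing by the mean condition, so no
    -- convergence of the medians is required.
    have h1 : A ≤ (∫⁻ x, ENNReal.ofReal (|u k x - c|) ^ p ∂m.measure) ^ (1 / p) + ε k := by
      calc A ≤ (∫⁻ x, ENNReal.ofReal (|f x - c|) ^ p ∂m.measure) ^ (1 / p) :=
            ENNReal.rpow_le_rpow (lintegral_abs_rpow_le_of_mean_eq_zero hp hfL h0 c) hpi.le
        _ ≤ (∫⁻ x, ((fun x => ENNReal.ofReal (|u k x - c|)) +
              fun x => ENNReal.ofReal (|u k x - f x|)) x ^ p ∂m.measure) ^ (1 / p) := by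
            refine ENNReal.rpow_le_rpow (lintegral_mono fun x => ENNReal.rpow_le_rpow ?_ hp0.le) hpi.le
            rw [Pi.add_apply, ← ENNReal.ofReal_add (abs_nonneg _) (abs_nonneg _)]
            refine ENNReal.ofReal_le_ofReal ?_
            rw [abs_sub_comm (u k x) (f x), add_comm]
            exact abs_sub_le _ _ _
        _ ≤ _ := ENNReal.lintegral_Lp_add_le
            (continuous_abs.measurable.comp_aemeasurable (hum.sub_const c)).ennreal_ofReal
            (continuous_abs.measurable.comp_aemeasurable (hum.sub hfm)).ennreal_ofReal hp.le
    have h2 : (∫⁻ x, ENNReal.ofReal (F.dual x (differential (u k) x)) ^ p ∂m.measure) ^ (1 / p) ≤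
        D + δ k := by
      calc _ ≤ (∫⁻ x, ((fun x => ENNReal.ofReal (F.dual x (α x))) +
              fun x => ENNReal.ofReal (F.dual x (differential (u k) x - α x))) x ^ p
                ∂m.measure) ^ (1 / p) := by
            refine ENNReal.rpow_le_rpow (lintegral_mono fun x => ENNReal.rpow_le_rpow ?_ hp0.le) hpi.le
            rw [Pi.add_apply, ← ENNReal.ofReal_add (F.dual_nonneg _ _) (F.dual_nonneg _ _)]
            refine ENNReal.ofReal_le_ofReal ?_
            -- `F*` need not be symmetric: this uses the difference `du_k - α` in the order in which
            -- it tends to zero.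
            have := F.dual_add_le x (α x) (differential (u k) x - α x)
            rwa [add_sub_cancel] at this
        _ ≤ _ := ENNReal.lintegral_Lp_add_le (F.aemeasurable_dual hα)
            (F.aemeasurable_dual ((measurableCovectorField_differential m.measure (hu k)).sub hα))
            hp.le
    calc r * A ≤ r * ((∫⁻ x, ENNReal.ofReal (|u k x - c|) ^ p ∂m.measure) ^ (1 / p) + ε k) := by
          gcongr
      _ = r * (∫⁻ x, ENNReal.ofReal (|u k x - c|) ^ p ∂m.measure) ^ (1 / p) + r * ε k :=
          mul_add _ _ _
      _ ≤ ENNReal.ofReal p * (D + δ k) + r * ε k := by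
          gcongr ?_ + _
          refine le_trans ?_ (hc.trans ?_)
          · gcongr
          · gcongr
  have hlim : Tendsto (fun k => ENNReal.ofReal p * (D + δ k) + r * ε k) atTop
      (𝓝 (ENNReal.ofReal p * (D + 0) + r * 0)) :=
    (ENNReal.Tendsto.const_mul (tendsto_const_nhds.add hδ) (Or.inr ENNReal.ofReal_ne_top)).add
      (ENNReal.Tendsto.const_mul hε (Or.inr ENNReal.coe_ne_top))
  rw [add_zero, mul_zero, add_zero] at hlim
  exact ge_of_tendsto' hlim hk

/-- Cheeger's inequality for the energy of an admissible function. -/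
theorem cheeger_div_rpow_le_energy [CompactSpace M] [Nonempty M] {p : ℝ} (hp : 1 < p)
    {f : M → ℝ} {α : (x : M) → TangentSpace (𝓡 (d + 1)) x →L[ℝ] ℝ} (hf : IsSobolev F m p f α)
    (hf0 : ¬ f =ᵐ[m.measure] 0) (h0 : ∫ x, |f x| ^ (p - 2) * f x ∂m.measure = 0) :
    (cheeger F m / ENNReal.ofReal p) ^ p ≤ energy F m p f α := by
  have hp0 : 0 < p := by linarith
  have hpi : 0 < 1 / p := by positivity
  have hm : m.measure ≠ 0 := fun h => hf0 (by rw [h]; simp [EventuallyEq])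
  have hfm : AEMeasurable f m.measure := hf.1.aestronglyMeasurable.aemeasurable
  have hE : energy F m p f α = (∫⁻ x, ENNReal.ofReal (F.dual x (α x)) ^ p ∂m.measure) /
      ∫⁻ x, ENNReal.ofReal (|f x|) ^ p ∂m.measure := by
    rw [energy]
    simp_rw [ENNReal.ofReal_rpow_of_nonneg (F.dual_nonneg _ _) hp0.le,
      ENNReal.ofReal_rpow_of_nonneg (abs_nonneg _) hp0.le, F.toFun_legendre]
  rw [hE]
  set I := ∫⁻ x, ENNReal.ofReal (|f x|) ^ p ∂m.measure with hI
  set J := ∫⁻ x, ENNReal.ofReal (F.dual x (α x)) ^ p ∂m.measure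
  have hItop : I ≠ ⊤ := by
    have := (hf.1.integrable_norm_rpow (by simpa using hp0) ENNReal.ofReal_ne_top).lintegral_lt_top
    rw [ENNReal.toReal_ofReal hp0.le] at this
    rw [hI]
    simp_rw [ENNReal.ofReal_rpow_of_nonneg (abs_nonneg _) hp0.le]
    exact this.ne
  have hI0 : I ≠ 0 := by
    intro h
    have hfa : AEMeasurable (fun x => ENNReal.ofReal (|f x|) ^ p) m.measure :=
      (continuous_abs.measurable.comp_aemeasurable hfm).ennreal_ofReal.pow_const p
    rw [hI, lintegral_eq_zero_iff' hfa] at h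
    refine hf0 (h.mono fun x hx => ?_)
    simpa [ENNReal.rpow_eq_zero_iff, hp0, hp0.not_gt] using hx
  have hI0' : I ^ (1 / p) ≠ 0 := by simp [ENNReal.rpow_eq_zero_iff, hI0, hItop]
  have hIt' : I ^ (1 / p) ≠ ⊤ := by simp [ENNReal.rpow_eq_top_iff, hI0, hItop]
  have hp' : ENNReal.ofReal p ≠ 0 := by simpa using hp0
  have key : cheeger F m / ENNReal.ofReal p ≤ (J / I) ^ (1 / p) := by
    rw [ENNReal.div_rpow_of_nonneg _ _ hpi.le,
      ENNReal.div_le_iff_le_mul (Or.inl hp') (Or.inl ENNReal.ofReal_ne_top), mul_comm,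
      ← mul_div_assoc]
    -- Exhaust the possibly infinite left-hand side by finite numbers, to which the limit argument
    -- applies.
    refine ENNReal.le_of_forall_nnreal_lt fun r hr => ?_
    rw [ENNReal.le_div_iff_mul_le (Or.inl hI0') (Or.inl hIt')]
    exact cheeger_mul_norm_le_of_isSobolev F m hm hp hf h0 hr.le
  calc (cheeger F m / ENNReal.ofReal p) ^ p ≤ ((J / I) ^ (1 / p)) ^ p :=
        ENNReal.rpow_le_rpow key hp0.le
    _ = J / I := by
        rw [← ENNReal.rpow_mul, one_div_mul_cancel hp0.ne', ENNReal.rpow_one]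

end Limit

end
end Finsler

/-! ### The eigenvalue estimate -/

theorem mainTheorem3 {d : ℕ} {M : Type*} [TopologicalSpace M] [T2Space M] [CompactSpace M]
    [ConnectedSpace M] [ChartedSpace (Finsler.Model d) M] [IsManifold (𝓡 (d + 1)) ∞ M]
    [MeasurableSpace M] [BorelSpace M]
    (F : Finsler.Metric d M) (m : Finsler.SmoothMeasure d M)
    (σ : ℝ) (hσ : F.concavity ≤ ENNReal.ofReal σ) (p : ℝ) (hp : 1 < p) :
    (Finsler.cheeger F m / ENNReal.ofReal (σ * p)) ^ p ≤ Finsler.firstEigenvalue F m p := by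
  have : SecondCountableTopology M :=
    ChartedSpace.secondCountable_of_sigmaCompact (Finsler.Model d) M
  have hσ1 : 1 ≤ σ := by
    have := F.one_le_concavity.trans hσ
    rwa [← ENNReal.ofReal_one, ENNReal.ofReal_le_ofReal_iff', or_iff_left (by norm_num)] at this
  refine le_iInf fun f => le_iInf fun α => le_iInf fun hf => le_iInf fun hf0 => le_iInf fun h0 => ?_
  -- The energy bound has `p` in the denominator; enlarging it to `σ * p` only weakens the estimate.
  refine le_trans ?_ (Finsler.cheeger_div_rpow_le_energy F m hp hf hf0 h0)
  gcongr
  nlinarith
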